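/- Let $p \ge 5$ be a prime, let $\mathrm{ord}$ be the additive valuation of $\mathbb{C}_p$ with $\mathrm{ord}(p)=1$, and fix $\pi \in \mathbb{C}_p$ with $\pi^{p-1} = -p$. Let $b, b'$ be real numbers with $b \ge b' > 0$ and $b > \frac{1}{p-1}$. Let $L(b')$ be the ring of power series $\sum_{i \ge 0} B_i a^i$ over $\mathbb{C}_p$ for which there is $\rho \in \mathbb{R}$ with $\mathrm{ord}(B_i) \ge \frac{2}{3} b' i + \rho$ for all $i$. Let $\mathcal{K}(b',b)$ be the $L(b')$-module of power series $\sum_{i,j \ge 0} B_{ij} a^i x^j$ over $\mathbb{C}_p$ for which there is $\rho \in \mathbb{R}$ with $\mathrm{ord}(B_{ij}) \ge \frac{2}{3} b' i + \frac{1}{3} b j + \rho$ for all $i,j$, and let $x\mathcal{K}(b',b)$ be the submodule of its elements that are divisible by $x$. On $\mathcal{K}(b',b)$ consider the commuting operators $$D_a = x\frac{\partial}{\partial x} + \pi(3x^3 + ax), \qquad \partial_a = a\frac{\partial}{\partial a} + \pi a x,$$ and let $\mathcal{M}_a(b',b) = x\mathcal{K}(b',b)/D_a\mathcal{K}(b',b)$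 be the relative cohomology of the family $x^3+ax$, an $L(b')$-module on which $\partial_a$ acts. For $k \ge 1$ let $\mathcal{M}_a^{(k)}(b',b)$ be the $k$-th symmetric power of $\mathcal{M}_a(b',b)$ over $L(b')$, and extend $\partial_a$ to it additively by $$\partial_a(u_1 \cdots u_k) = \sum_{i=1}^k u_1 \cdots u_{i-1}\, \partial_a(u_i)\, u_{i+1} \cdots u_k \qquad (u_1, \dots, u_k \in \mathcal{M}_a(b',b)).$$ Let $k$ be a positive integer. If $k$ is odd, or if $k$ is even and $k < 2p$, then $$H_k^0 := \ker\bigl(\partial_a \mid \mathcal{M}_a^{(k)}(b',b)\bigr) = 0.$$ -/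

import Mathlib

noncomputable section

namespace AiryCohomology

set_option linter.unusedSectionVars false

/-! ### The derivation induced on a symmetric algebra by a connection -/

section SymmetricAlgebraDerivation

variable {C R M : Type*} [CommRing C] [CommRing R] [Algebra C R] [AddCommGroup M] [Module R M]
  [Module C M] [IsScalarTower C R M]

/-- The ring `S[ε]` of dual numbers over `S = Sym_R M`, as a type without its standard `R`-algebra
structure. -/
def Jet (R M : Type*) [CommRing R] [AddCommGroup M] [Module R M] : Type _ :=
  TrivSqZeroExt (SymmetricAlgebra R M) (SymmetricAlgebra R M)

instance : CommRing (Jet R M) :=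
  inferInstanceAs (CommRing (TrivSqZeroExt (SymmetricAlgebra R M) (SymmetricAlgebra R M)))

/-- The element `s + ε t` of `S[ε]`. -/
def Jet.mk (s t : SymmetricAlgebra R M) : Jet R M := (s, t)

/-- The component `s` of `s + ε t`. -/
def Jet.re (z : Jet R M) : SymmetricAlgebra R M := TrivSqZeroExt.fst z

/-- The component `t` of `s + ε t`. -/
def Jet.eps (z : Jet R M) : SymmetricAlgebra R M := TrivSqZeroExt.snd z

theorem Jet.ext' {z w : Jet R M} (h : z.re = w.re) (h' : z.eps = w.eps) : z = w :=
  TrivSqZeroExt.ext h h'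

@[simp] theorem Jet.re_mk (s t : SymmetricAlgebra R M) : (Jet.mk s t).re = s := rfl
@[simp] theorem Jet.eps_mk (s t : SymmetricAlgebra R M) : (Jet.mk s t).eps = t := rfl
@[simp] theorem Jet.re_add (z w : Jet R M) : (z + w).re = z.re + w.re := rfl
@[simp] theorem Jet.eps_add (z w : Jet R M) : (z + w).eps = z.eps + w.eps := rfl
@[simp] theorem Jet.re_zero : (0 : Jet R M).re = 0 := rfl
@[simp] theorem Jet.eps_zero : (0 : Jet R M).eps = 0 := rfl
@[simp] theorem Jet.re_one : (1 : Jet R M).re = 1 := rfl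
@[simp] theorem Jet.eps_one : (1 : Jet R M).eps = 0 := rfl
@[simp] theorem Jet.re_mul (z w : Jet R M) : (z * w).re = z.re * w.re := rfl
@[simp] theorem Jet.eps_mul (z w : Jet R M) :
    (z * w).eps = z.re * w.eps + z.eps * w.re := by
  change z.re • w.eps + MulOpposite.op w.re • z.eps = _
  rw [smul_eq_mul, op_smul_eq_mul]

/-- The ring homomorphism `R → S[ε]`, `r ↦ r + ε δ(r)`. -/
def jetScalar (M : Type*) [AddCommGroup M] [Module R M] (δ : Derivation C R R) :
    R →+* Jet R M where
  toFun r := Jet.mk (algebraMap R _ r) (algebraMap R _ (δ r))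
  map_one' := by apply Jet.ext' <;> simp
  map_zero' := by apply Jet.ext' <;> simp
  map_add' r s := by apply Jet.ext' <;> simp
  map_mul' r s := by
    apply Jet.ext'
    · simp
    · simp [mul_comm]

/-- For a connection `D` on `M` over the derivation `δ` of `R`, the ring homomorphism
`S → S[ε]` that extends `r ↦ r + ε δ(r)` on `R` and `m ↦ m + ε D(m)` on `M`. -/
def jetHom (δ : Derivation C R R) (D : M →ₗ[C] M)
    (hD : ∀ (r : R) (m : M), D (r • m) = δ r • m + r • D m) :
    SymmetricAlgebra R M →+* Jet R M :=
  letI : Algebra R (Jet R M) := (jetScalar M δ).toAlgebra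
  (SymmetricAlgebra.lift (A := Jet R M)
    { toFun := fun m => Jet.mk (SymmetricAlgebra.ι R M m) (SymmetricAlgebra.ι R M (D m))
      map_add' := fun m n => by apply Jet.ext' <;> simp
      map_smul' := fun r m => by
        rw [Algebra.smul_def]
        change _ = jetScalar M δ r * _
        apply Jet.ext'
        · simp [jetScalar, Algebra.smul_def]
        · simp [jetScalar, Algebra.smul_def, hD, add_comm] } :
    SymmetricAlgebra R M →ₐ[R] Jet R M).toRingHom

section

variable (δ : Derivation C R R) (D : M →ₗ[C] M)
  (hD : ∀ (r : R) (m : M), D (r • m) = δ r • m + r • D m)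

theorem jetHom_algebraMap (r : R) :
    jetHom δ D hD (algebraMap R _ r) = Jet.mk (algebraMap R _ r) (algebraMap R _ (δ r)) := by
  let _ : Algebra R (Jet R M) := (jetScalar M δ).toAlgebra
  exact AlgHom.commutes (SymmetricAlgebra.lift (A := Jet R M) _) r

theorem jetHom_ι (m : M) :
    jetHom δ D hD (SymmetricAlgebra.ι R M m) =
      Jet.mk (SymmetricAlgebra.ι R M m) (SymmetricAlgebra.ι R M (D m)) := by
  let _ : Algebra R (Jet R M) := (jetScalar M δ).toAlgebra
  exact SymmetricAlgebra.lift_ι_apply (A := Jet R M) _ m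

theorem jetHom_re (s : SymmetricAlgebra R M) : (jetHom δ D hD s).re = s := by
  induction s using SymmetricAlgebra.induction with
  | algebraMap r => simp [jetHom_algebraMap]
  | ι m => simp [jetHom_ι]
  | mul a b ha hb => rw [map_mul, Jet.re_mul, ha, hb]
  | add a b ha hb => rw [map_add, Jet.re_add, ha, hb]

theorem jetHom_eps_mul (s t : SymmetricAlgebra R M) :
    (jetHom δ D hD (s * t)).eps = s * (jetHom δ D hD t).eps + t * (jetHom δ D hD s).eps := by
  rw [map_mul, Jet.eps_mul, jetHom_re, jetHom_re, mul_comm t]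

/-- The derivation of `Sym_R M` that extends the derivation `δ` of `R` and the connection `D`
of `M`, so that `u₁ ⋯ u_k ↦ ∑ᵢ u₁ ⋯ D(uᵢ) ⋯ u_k` for `uᵢ` in `M`. -/
def symDerivation : Derivation C (SymmetricAlgebra R M) (SymmetricAlgebra R M) where
  toFun s := (jetHom δ D hD s).eps
  map_add' s t := by simp
  map_smul' c s := by
    have h : algebraMap C (SymmetricAlgebra R M) c =
        algebraMap R (SymmetricAlgebra R M) (algebraMap C R c) :=
      IsScalarTower.algebraMap_apply C R (SymmetricAlgebra R M) c
    rw [Algebra.smul_def, jetHom_eps_mul, h, jetHom_algebraMap]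
    simp [Algebra.smul_def, h]
  map_one_eq_zero' := by simp
  leibniz' s t := by simpa using jetHom_eps_mul δ D hD s t

theorem symDerivation_algebraMap (r : R) :
    symDerivation δ D hD (algebraMap R _ r) = algebraMap R _ (δ r) := by
  change (jetHom δ D hD _).eps = _
  rw [jetHom_algebraMap, Jet.eps_mk]

theorem symDerivation_ι (m : M) :
    symDerivation δ D hD (SymmetricAlgebra.ι R M m) = SymmetricAlgebra.ι R M (D m) := by
  change (jetHom δ D hD _).eps = _
  rw [jetHom_ι, Jet.eps_mk]

end

/-- The `k`-th symmetric power of `M` over `R`: the homogeneous part of degree `k` of the symmetric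
algebra, that is, the `R`-span of the products `u₁ ⋯ u_k` with `uᵢ` in `M`. -/
def symPow (R M : Type*) [CommRing R] [AddCommGroup M] [Module R M] (k : ℕ) :
    Submodule R (SymmetricAlgebra R M) :=
  LinearMap.range (SymmetricAlgebra.ι R M) ^ k

theorem symDerivation_mem_symPow (δ : Derivation C R R) (D : M →ₗ[C] M)
    (hD : ∀ (r : R) (m : M), D (r • m) = δ r • m + r • D m) (k : ℕ)
    (u : SymmetricAlgebra R M) (hu : u ∈ symPow R M k) :
    symDerivation δ D hD u ∈ symPow R M k := by
  unfold symPow at hu ⊢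
  induction k generalizing u with
  | zero =>
    rw [pow_zero, Submodule.mem_one] at hu ⊢
    obtain ⟨r, rfl⟩ := hu
    exact ⟨δ r, (symDerivation_algebraMap δ D hD r).symm⟩
  | succ k ih =>
    rw [pow_succ] at hu ⊢
    induction hu using Submodule.mul_induction_on' with
    | mem_mul_mem a ha c hc =>
      obtain ⟨m, rfl⟩ := hc
      rw [Derivation.leibniz, symDerivation_ι, smul_eq_mul, smul_eq_mul,
        mul_comm (SymmetricAlgebra.ι R M m)]
      exact Submodule.add_mem _ (Submodule.mul_mem_mul ha ⟨_, rfl⟩)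
        (Submodule.mul_mem_mul (ih a ha) ⟨_, rfl⟩)
    | add a _ c _ ha hc => rw [map_add]; exact Submodule.add_mem _ ha hc

/-- The operator induced on the `k`-th symmetric power of `M` by a connection `D` over `δ`. -/
def symPowConnection (δ : Derivation C R R) (D : M →ₗ[C] M)
    (hD : ∀ (r : R) (m : M), D (r • m) = δ r • m + r • D m) (k : ℕ) :
    symPow R M k →ₗ[C] symPow R M k where
  toFun u := ⟨symDerivation δ D hD u, symDerivation_mem_symPow δ D hD k u u.2⟩
  map_add' u v := Subtype.ext (by simp)
  map_smul' c u := Subtype.ext (by simp)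

end SymmetricAlgebraDerivation

/-! ### The spaces `L(b')`, `K(b',b)` and the relative cohomology `M_a(b',b)` for `x ^ 3 + a x` -/

section Relative

/- The constructions make sense over every non-archimedean field in the place of `ℂ_p`. -/

variable (C : Type) [NormedField C] [IsUltrametricDist C] (p : ℕ) [Fact p.Prime]

/-- `ord(c) ≥ r`, where `ord(c) = - log_p ‖c‖`. On `ℂ_p` this is the additive valuation with
`ord(p) = 1`. -/
def OrdGE {C : Type} [NormedField C] (p : ℕ) (c : C) (r : ℝ) : Prop := ‖c‖ ≤ (p : ℝ) ^ (-r)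

/-- Power series in the variable `a`. -/
abbrev SeriesA : Type := PowerSeries C

/-- Power series in `x` whose coefficients are power series in `a`. This is not an abbreviation,
because `C⟦a⟧` has two actions on `C⟦a⟧⟦x⟧` in the library: one on the coefficients, which is the
one used here, and one through `C⟦x⟧ ⊆ C⟦a⟧⟦x⟧`. -/
def SeriesAX : Type := PowerSeries (SeriesA C)

instance : CommRing (SeriesAX C) := inferInstanceAs (CommRing (PowerSeries (SeriesA C)))

/-- A power series in `a`, as a power series in `a` and `x`. -/
def ofA : SeriesA C →+* SeriesAX C := (PowerSeries.C : SeriesA C →+* PowerSeries (SeriesA C))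

instance : Algebra (SeriesA C) (SeriesAX C) := (ofA C).toAlgebra

instance : Algebra C (SeriesAX C) :=
  ((ofA C).comp (algebraMap C (SeriesA C))).toAlgebra

instance : IsScalarTower C (SeriesA C) (SeriesAX C) := IsScalarTower.of_algebraMap_eq fun _ => rfl

/-- The variable `x`. -/
def varX : SeriesAX C := (PowerSeries.X : PowerSeries (SeriesA C))

variable {C p}

/-- The coefficient of `x ^ j`, a power series in `a`. -/
def coeffX (j : ℕ) (g : SeriesAX C) : SeriesA C :=
  PowerSeries.coeff j (show PowerSeries (SeriesA C) from g)

/-- The series `∑ⱼ Aⱼ(a) xʲ`. -/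
def mkX (A : ℕ → SeriesA C) : SeriesAX C := (PowerSeries.mk A : PowerSeries (SeriesA C))

theorem seriesAX_ext {f g : SeriesAX C} (h : ∀ j, coeffX j f = coeffX j g) : f = g :=
  PowerSeries.ext h

@[simp] theorem coeffX_mkX (A : ℕ → SeriesA C) (j : ℕ) : coeffX j (mkX A) = A j :=
  PowerSeries.coeff_mk _ _

@[simp] theorem coeffX_zero (j : ℕ) : coeffX j (0 : SeriesAX C) = 0 :=
  map_zero (PowerSeries.coeff (R := SeriesA C) j)

@[simp] theorem coeffX_add (j : ℕ) (f g : SeriesAX C) :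
    coeffX j (f + g) = coeffX j f + coeffX j g :=
  map_add (PowerSeries.coeff (R := SeriesA C) j) f g

theorem coeffX_mul (j : ℕ) (f g : SeriesAX C) :
    coeffX j (f * g) = ∑ q ∈ Finset.HasAntidiagonal.antidiagonal j, coeffX q.1 f * coeffX q.2 g :=
  PowerSeries.coeff_mul (R := SeriesA C) j f g

theorem coeffX_ofA (j : ℕ) (f : SeriesA C) : coeffX j (ofA C f) = if j = 0 then f else 0 :=
  PowerSeries.coeff_C j f

theorem coeffX_varX_pow (j n : ℕ) : coeffX j (varX C ^ n) = if j = n then 1 else 0 :=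
  PowerSeries.coeff_X_pow (R := SeriesA C) j n

@[simp] theorem coeffX_smul (j : ℕ) (f : SeriesA C) (g : SeriesAX C) :
    coeffX j (f • g) = f * coeffX j g :=
  PowerSeries.coeff_C_mul (R := SeriesA C) j g f

@[simp] theorem coeffX_smul' (j : ℕ) (c : C) (g : SeriesAX C) :
    coeffX j (c • g) = c • coeffX j g := by
  rw [← algebraMap_smul (SeriesA C) c g, coeffX_smul, Algebra.smul_def]

theorem OrdGE.zero (r : ℝ) : OrdGE p (0 : C) r := by
  unfold OrdGE; rw [norm_zero]; positivity

theorem OrdGE.mono {c : C} {r s : ℝ} (h : OrdGE p c r) (hs : s ≤ r) : OrdGE p c s := by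
  have hp : (1 : ℝ) ≤ p := by exact_mod_cast (Fact.out : p.Prime).one_le
  exact le_trans h (Real.rpow_le_rpow_of_exponent_le hp (by linarith))

theorem OrdGE.add {c e : C} {r : ℝ} (h : OrdGE p c r) (h' : OrdGE p e r) :
    OrdGE p (c + e) r :=
  le_trans (IsUltrametricDist.norm_add_le_max c e) (max_le h h')

theorem OrdGE.mul {c e : C} {r s : ℝ} (h : OrdGE p c r) (h' : OrdGE p e s) :
    OrdGE p (c * e) (r + s) := by
  have hp : (0 : ℝ) < p := by exact_mod_cast (Fact.out : p.Prime).pos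
  unfold OrdGE at *
  rw [norm_mul, neg_add, Real.rpow_add hp]
  exact mul_le_mul h h' (norm_nonneg _) (by positivity)

theorem OrdGE.natCast (n : ℕ) : OrdGE p (n : C) 0 := by
  unfold OrdGE
  rw [neg_zero, Real.rpow_zero]
  exact IsUltrametricDist.norm_natCast_le_one C n

theorem OrdGE.one : OrdGE p (1 : C) 0 := by simpa using OrdGE.natCast (C := C) (p := p) 1

theorem OrdGE.sum {ι : Type*} (s : Finset ι) (f : ι → C) {r : ℝ}
    (h : ∀ i ∈ s, OrdGE p (f i) r) : OrdGE p (∑ i ∈ s, f i) r :=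
  Finset.sum_induction f (fun c => OrdGE p c r) (fun _ _ => OrdGE.add) (OrdGE.zero r) h

theorem OrdGE.exists (c : C) : ∃ r : ℝ, OrdGE p c r := by
  have hp : (1 : ℝ) < p := by exact_mod_cast (Fact.out : p.Prime).one_lt
  obtain ⟨n, hn⟩ := pow_unbounded_of_one_lt ‖c‖ hp
  refine ⟨-(n : ℝ), ?_⟩
  unfold OrdGE
  rw [neg_neg, Real.rpow_natCast]
  exact hn.le

variable (C p)

/-- `L(b'; ρ)`: the series `∑ Bᵢ aⁱ` with `ord(Bᵢ) ≥ b' (1 - 1/3) i + ρ` for all `i`. -/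
def LRho (b' ρ : ℝ) : Set (SeriesA C) :=
  {f | ∀ i : ℕ, OrdGE p (PowerSeries.coeff i f) (b' * (1 - 1 / 3) * i + ρ)}

/-- `K(b', b; ρ)`: the series `∑ Bᵢⱼ aⁱ xʲ` with `ord(Bᵢⱼ) ≥ b' (1 - 1/3) i + b j / 3 + ρ` for all
`i`, `j`. -/
def KRho (b' b ρ : ℝ) : Set (SeriesAX C) :=
  {g | ∀ i j : ℕ, OrdGE p (PowerSeries.coeff i (coeffX j g))
    (b' * (1 - 1 / 3) * i + b * j / 3 + ρ)}

variable {C p}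

theorem LRho_mono {b' ρ σ : ℝ} (h : σ ≤ ρ) : LRho C p b' ρ ⊆ LRho C p b' σ :=
  fun _ hf i => (hf i).mono (by linarith)

theorem KRho_mono {b' b ρ σ : ℝ} (h : σ ≤ ρ) : KRho C p b' b ρ ⊆ KRho C p b' b σ :=
  fun _ hg i j => (hg i j).mono (by linarith)

theorem LRho_add {b' ρ : ℝ} {f g : SeriesA C} (hf : f ∈ LRho C p b' ρ) (hg : g ∈ LRho C p b' ρ) :
    f + g ∈ LRho C p b' ρ := fun i => by
  rw [map_add]; exact (hf i).add (hg i)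

theorem KRho_add {b' b ρ : ℝ} {f g : SeriesAX C} (hf : f ∈ KRho C p b' b ρ)
    (hg : g ∈ KRho C p b' b ρ) : f + g ∈ KRho C p b' b ρ := fun i j => by
  rw [coeffX_add, map_add]; exact (hf i j).add (hg i j)

theorem LRho_mul {b' ρ σ : ℝ} {f g : SeriesA C} (hf : f ∈ LRho C p b' ρ) (hg : g ∈ LRho C p b' σ) :
    f * g ∈ LRho C p b' (ρ + σ) := fun i => by
  rw [PowerSeries.coeff_mul]
  refine OrdGE.sum _ _ fun q hq => ((hf q.1).mul (hg q.2)).mono (le_of_eq ?_)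
  rw [← Finset.HasAntidiagonal.mem_antidiagonal.1 hq]; push_cast; ring

theorem KRho_mul {b' b ρ σ : ℝ} {f g : SeriesAX C} (hf : f ∈ KRho C p b' b ρ)
    (hg : g ∈ KRho C p b' b σ) : f * g ∈ KRho C p b' b (ρ + σ) := fun i j => by
  rw [coeffX_mul, map_sum]
  refine OrdGE.sum _ _ fun q hq => ?_
  rw [PowerSeries.coeff_mul]
  refine OrdGE.sum _ _ fun s hs => ((hf s.1 q.1).mul (hg s.2 q.2)).mono (le_of_eq ?_)
  rw [← Finset.HasAntidiagonal.mem_antidiagonal.1 hq,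
    ← Finset.HasAntidiagonal.mem_antidiagonal.1 hs]
  push_cast; ring

theorem KRho_ofA {b' b ρ : ℝ} {f : SeriesA C} (hf : f ∈ LRho C p b' ρ) :
    ofA C f ∈ KRho C p b' b ρ := fun i j => by
  rw [coeffX_ofA]
  split_ifs with h
  · subst h; simpa using hf i
  · rw [map_zero]; exact OrdGE.zero _

theorem KRho_varX_pow (b' b : ℝ) (n : ℕ) :
    varX C ^ n ∈ KRho C p b' b (-(b * n / 3)) := fun i j => by
  rw [coeffX_varX_pow]
  split_ifs with h
  · subst h
    rw [PowerSeries.coeff_one]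
    split_ifs with h
    · subst h
      exact OrdGE.one.mono (by simp)
    · exact OrdGE.zero _
  · rw [map_zero]; exact OrdGE.zero _

theorem LRho_C (b' : ℝ) (c : C) : ∃ ρ, PowerSeries.C c ∈ LRho C p b' ρ := by
  obtain ⟨r, hr⟩ := OrdGE.exists (p := p) c
  refine ⟨r, fun i => ?_⟩
  rw [PowerSeries.coeff_C]
  split_ifs with h
  · subst h; simpa using hr
  · exact OrdGE.zero _

theorem LRho_X (b' : ℝ) : (PowerSeries.X : SeriesA C) ∈ LRho C p b' (-(b' * (1 - 1 / 3))) :=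
  fun i => by
    rw [PowerSeries.coeff_X]
    split_ifs with h
    · subst h
      exact OrdGE.one.mono (by simp)
    · exact OrdGE.zero _

variable (C p)

/-- `L(b')`, the union of the spaces `L(b'; ρ)`, as a subalgebra of the power series in `a`. -/
def LSub (b' : ℝ) : Subalgebra C (SeriesA C) where
  carrier := {f | ∃ ρ : ℝ, f ∈ LRho C p b' ρ}
  mul_mem' := by
    rintro f g ⟨ρ, hf⟩ ⟨σ, hg⟩
    exact ⟨ρ + σ, LRho_mul hf hg⟩
  add_mem' := by
    rintro f g ⟨ρ, hf⟩ ⟨σ, hg⟩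
    exact ⟨min ρ σ, LRho_add (LRho_mono (min_le_left _ _) hf) (LRho_mono (min_le_right _ _) hg)⟩
  algebraMap_mem' c := LRho_C b' c

/-- The ring `L(b')`. -/
def L (b' : ℝ) : Type := LSub C p b'

instance (b' : ℝ) : CommRing (L C p b') := inferInstanceAs (CommRing (LSub C p b'))

instance (b' : ℝ) : Algebra C (L C p b') := inferInstanceAs (Algebra C (LSub C p b'))

/-- The inclusion of `L(b')` into the power series in `a`. -/
def L.val {b' : ℝ} : L C p b' →ₐ[C] SeriesA C := (LSub C p b').val

instance (b' : ℝ) : Algebra (L C p b') (SeriesA C) := (L.val C p).toRingHom.toAlgebra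

instance (b' : ℝ) : Algebra (L C p b') (SeriesAX C) :=
  ((ofA C).comp (L.val C p).toRingHom).toAlgebra

instance (b' : ℝ) : IsScalarTower (L C p b') (SeriesA C) (SeriesAX C) :=
  IsScalarTower.of_algebraMap_eq fun _ => rfl

instance (b' : ℝ) : IsScalarTower C (L C p b') (SeriesAX C) :=
  IsScalarTower.of_algebraMap_eq fun _ => rfl

theorem L_smul_def {b' : ℝ} (f : L C p b') (g : SeriesAX C) :
    f • g = ofA C (L.val C p f) * g :=
  Algebra.smul_def f g

/-- `K(b', b)`, the union of the spaces `K(b', b; ρ)`, as an `L(b')`-module. -/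
def K (b' b : ℝ) : Submodule (L C p b') (SeriesAX C) where
  carrier := {g | ∃ ρ : ℝ, g ∈ KRho C p b' b ρ}
  zero_mem' := ⟨0, fun i j => by rw [coeffX_zero, map_zero]; exact OrdGE.zero _⟩
  add_mem' := by
    rintro f g ⟨ρ, hf⟩ ⟨σ, hg⟩
    exact ⟨min ρ σ, KRho_add (KRho_mono (min_le_left _ _) hf) (KRho_mono (min_le_right _ _) hg)⟩
  smul_mem' := by
    rintro f g ⟨σ, hg⟩
    obtain ⟨ρ, hf⟩ := f.2
    refine ⟨ρ + σ, ?_⟩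
    rw [L_smul_def]
    exact KRho_mul (KRho_ofA hf) hg

/-- `x K(b', b)`: the elements of `K(b', b)` that are divisible by `x`. -/
def xK (b' b : ℝ) : Submodule (L C p b') (SeriesAX C) where
  carrier := {g | g ∈ K C p b' b ∧ varX C ∣ g}
  zero_mem' := ⟨Submodule.zero_mem _, dvd_zero _⟩
  add_mem' hf hg := ⟨Submodule.add_mem _ hf.1 hg.1, dvd_add hf.2 hg.2⟩
  smul_mem' f g hg := by
    refine ⟨Submodule.smul_mem _ f hg.1, ?_⟩
    rw [L_smul_def]
    exact hg.2.mul_left _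

/-- The derivation `a d/da` of the ring of power series in `a`. -/
def eulerA : Derivation C (SeriesA C) (SeriesA C) :=
  (PowerSeries.X : SeriesA C) • PowerSeries.derivative C

theorem coeff_eulerA (f : SeriesA C) (i : ℕ) :
    PowerSeries.coeff i (eulerA C f) = (i : C) * PowerSeries.coeff i f := by
  change PowerSeries.coeff i (PowerSeries.X * PowerSeries.derivative C f) = _
  cases i with
  | zero => simp
  | succ n => rw [PowerSeries.coeff_succ_X_mul, PowerSeries.coeff_derivative]; push_cast; ring

/-- The operator `a ∂/∂a` on power series in `a` and `x`. -/
def eulerAX : SeriesAX C →ₗ[C] SeriesAX C where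
  toFun g := mkX fun j => eulerA C (coeffX j g)
  map_add' f g := seriesAX_ext fun j => by simp
  map_smul' c g := seriesAX_ext fun j => by simp

/-- The operator `x ∂/∂x` on power series in `a` and `x`. -/
def eulerX : SeriesAX C →ₗ[SeriesA C] SeriesAX C where
  toFun g := mkX fun j => (j : SeriesA C) * coeffX j g
  map_add' f g := seriesAX_ext fun j => by simp [mul_add]
  map_smul' c g := seriesAX_ext fun j => by simp [mul_left_comm]

theorem coeffX_eulerAX (g : SeriesAX C) (j : ℕ) :
    coeffX j (eulerAX C g) = eulerA C (coeffX j g) :=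
  coeffX_mkX (fun j => eulerA C (coeffX j g)) j

theorem coeffX_eulerX (g : SeriesAX C) (j : ℕ) :
    coeffX j (eulerX C g) = (j : SeriesA C) * coeffX j g :=
  coeffX_mkX (fun j => (j : SeriesA C) * coeffX j g) j

theorem eulerAX_mul (f g : SeriesAX C) :
    eulerAX C (f * g) = f * eulerAX C g + eulerAX C f * g := by
  refine seriesAX_ext fun j => ?_
  rw [coeffX_eulerAX, coeffX_add, coeffX_mul, coeffX_mul, coeffX_mul, map_sum,
    ← Finset.sum_add_distrib]
  refine Finset.sum_congr rfl fun q _ => ?_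
  rw [coeffX_eulerAX, coeffX_eulerAX, Derivation.leibniz, smul_eq_mul, smul_eq_mul]
  ring

theorem eulerX_mul (f g : SeriesAX C) :
    eulerX C (f * g) = f * eulerX C g + eulerX C f * g := by
  refine seriesAX_ext fun j => ?_
  rw [coeffX_eulerX, coeffX_add, coeffX_mul, coeffX_mul, coeffX_mul, Finset.mul_sum,
    ← Finset.sum_add_distrib]
  refine Finset.sum_congr rfl fun q hq => ?_
  rw [coeffX_eulerX, coeffX_eulerX, ← Finset.HasAntidiagonal.mem_antidiagonal.1 hq]
  push_cast
  ring

variable (π : C)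

/-- The series `π a x`. -/
def piAX : SeriesAX C := ofA C (PowerSeries.C π * PowerSeries.X) * varX C

/-- The series `π (3 x³ + a x)`. -/
def potential : SeriesAX C := ofA C (PowerSeries.C (π * 3)) * varX C ^ 3 + piAX C π

/-- The operator `D_a = x ∂/∂x + π (3 x³ + a x)`. -/
def Da : SeriesAX C →ₗ[SeriesA C] SeriesAX C :=
  eulerX C + LinearMap.mulLeft (SeriesA C) (potential C π)

/-- The operator `∂_a = a d/da + π a x`. -/
def partialA : SeriesAX C →ₗ[C] SeriesAX C :=
  eulerAX C + LinearMap.mulLeft C (piAX C π)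

theorem eulerA_mem {b' : ℝ} {f : SeriesA C} (hf : f ∈ LSub C p b') : eulerA C f ∈ LSub C p b' := by
  obtain ⟨ρ, hf⟩ := hf
  refine ⟨ρ, fun i => ?_⟩
  rw [coeff_eulerA]
  exact ((OrdGE.natCast i).mul (hf i)).mono (by linarith)

theorem K_mul_mem {b' b : ℝ} {f g : SeriesAX C} (hf : f ∈ K C p b' b) (hg : g ∈ K C p b' b) :
    f * g ∈ K C p b' b := by
  obtain ⟨ρ, hf⟩ := hf
  obtain ⟨σ, hg⟩ := hg
  exact ⟨ρ + σ, KRho_mul hf hg⟩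

theorem piAX_mem (b' b : ℝ) : piAX C π ∈ K C p b' b := by
  refine K_mul_mem C p ?_ ?_
  · obtain ⟨ρ, h⟩ := LRho_C (p := p) b' π
    exact ⟨_, KRho_ofA (LRho_mul h (LRho_X b'))⟩
  · have := KRho_varX_pow (C := C) (p := p) b' b 1
    rw [pow_one] at this
    exact ⟨_, this⟩

theorem potential_mem (b' b : ℝ) : potential C π ∈ K C p b' b := by
  refine Submodule.add_mem _ (K_mul_mem C p ?_ ⟨_, KRho_varX_pow b' b 3⟩) (piAX_mem C p π b' b)
  obtain ⟨ρ, h⟩ := LRho_C (p := p) b' (π * 3)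
  exact ⟨ρ, KRho_ofA h⟩

theorem eulerAX_mem {b' b : ℝ} {g : SeriesAX C} (hg : g ∈ K C p b' b) :
    eulerAX C g ∈ K C p b' b := by
  obtain ⟨ρ, hg⟩ := hg
  refine ⟨ρ, fun i j => ?_⟩
  rw [coeffX_eulerAX, coeff_eulerA]
  exact ((OrdGE.natCast i).mul (hg i j)).mono (by linarith)

theorem eulerX_mem {b' b : ℝ} {g : SeriesAX C} (hg : g ∈ K C p b' b) :
    eulerX C g ∈ K C p b' b := by
  obtain ⟨ρ, hg⟩ := hg
  refine ⟨ρ, fun i j => ?_⟩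
  have h : ((j : SeriesA C)) = PowerSeries.C (j : C) := by simp
  rw [coeffX_eulerX, h, PowerSeries.coeff_C_mul]
  exact ((OrdGE.natCast j).mul (hg i j)).mono (by linarith)

theorem partialA_mem_K {b' b : ℝ} {g : SeriesAX C} (hg : g ∈ K C p b' b) :
    partialA C π g ∈ K C p b' b :=
  Submodule.add_mem _ (eulerAX_mem C p hg) (K_mul_mem C p (piAX_mem C p π b' b) hg)

theorem Da_mem_K {b' b : ℝ} {g : SeriesAX C} (hg : g ∈ K C p b' b) : Da C π g ∈ K C p b' b :=
  Submodule.add_mem _ (eulerX_mem C p hg) (K_mul_mem C p (potential_mem C p π b' b) hg)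

theorem varX_dvd_iff (g : SeriesAX C) : varX C ∣ g ↔ coeffX 0 g = 0 :=
  (PowerSeries.X_dvd_iff (R := SeriesA C) (φ := g)).trans <| by
    exact iff_of_eq (congrArg (· = 0) (PowerSeries.coeff_zero_eq_constantCoeff_apply _).symm)

theorem varX_dvd_piAX : varX C ∣ piAX C π := Dvd.intro_left _ rfl

theorem varX_dvd_Da (g : SeriesAX C) : varX C ∣ Da C π g := by
  refine dvd_add ?_ (Dvd.dvd.mul_right ?_ g)
  · rw [varX_dvd_iff, coeffX_eulerX, Nat.cast_zero, zero_mul]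
  · exact dvd_add ((dvd_pow_self _ (by norm_num)).mul_left _) (varX_dvd_piAX C π)

theorem partialA_mem_xK {b' b : ℝ} {g : SeriesAX C} (hg : g ∈ xK C p b' b) :
    partialA C π g ∈ xK C p b' b := by
  refine ⟨partialA_mem_K C p π hg.1, dvd_add ?_ ((varX_dvd_piAX C π).mul_right g)⟩
  rw [varX_dvd_iff, coeffX_eulerAX, (varX_dvd_iff C g).1 hg.2, map_zero]

theorem eulerAX_ofA (f : SeriesA C) : eulerAX C (ofA C f) = ofA C (eulerA C f) := by
  refine seriesAX_ext fun j => ?_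
  rw [coeffX_eulerAX, coeffX_ofA, coeffX_ofA]
  split_ifs
  · rfl
  · rw [map_zero]

theorem eulerAX_varX_pow (n : ℕ) : eulerAX C (varX C ^ n) = 0 := by
  refine seriesAX_ext fun j => ?_
  rw [coeffX_eulerAX, coeffX_varX_pow]
  split_ifs <;> simp

theorem eulerX_ofA (f : SeriesA C) : eulerX C (ofA C f) = 0 := by
  refine seriesAX_ext fun j => ?_
  rw [coeffX_eulerX, coeffX_ofA]
  split_ifs with h <;> simp [h]

theorem eulerX_varX : eulerX C (varX C) = varX C := by
  refine seriesAX_ext fun j => ?_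
  have h := coeffX_varX_pow (C := C) j 1
  rw [pow_one] at h
  rw [coeffX_eulerX, h]
  split_ifs with h <;> simp [h]

theorem eulerA_C (c : C) : eulerA C (PowerSeries.C c) = 0 := by
  ext i
  rw [coeff_eulerA, PowerSeries.coeff_C]
  split_ifs with h <;> simp [h]

theorem eulerA_X : eulerA C PowerSeries.X = PowerSeries.X := by
  ext i
  rw [coeff_eulerA, PowerSeries.coeff_X]
  split_ifs with h <;> simp [h]

theorem eulerAX_piAX : eulerAX C (piAX C π) = piAX C π := by
  have h := eulerAX_varX_pow C 1
  rw [pow_one] at h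
  rw [piAX, eulerAX_mul, h, eulerAX_ofA, Derivation.leibniz, eulerA_C, eulerA_X]
  simp

theorem eulerAX_potential : eulerAX C (potential C π) = piAX C π := by
  rw [potential, map_add, eulerAX_piAX, eulerAX_mul, eulerAX_varX_pow, eulerAX_ofA, eulerA_C]
  simp

theorem eulerX_piAX : eulerX C (piAX C π) = piAX C π := by
  rw [piAX, eulerX_mul, eulerX_ofA, eulerX_varX, zero_mul, add_zero]

theorem eulerAX_eulerX (g : SeriesAX C) : eulerAX C (eulerX C g) = eulerX C (eulerAX C g) := by
  refine seriesAX_ext fun j => ?_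
  have h : ((j : SeriesA C)) = PowerSeries.C (j : C) := by simp
  rw [coeffX_eulerAX, coeffX_eulerX, coeffX_eulerX, coeffX_eulerAX, Derivation.leibniz, h,
    eulerA_C, smul_zero, add_zero, smul_eq_mul]

/-- The operators `∂_a` and `D_a` commute. -/
theorem partialA_Da (g : SeriesAX C) :
    partialA C π (Da C π g) = Da C π (partialA C π g) := by
  change eulerAX C (eulerX C g + potential C π * g) +
      piAX C π * (eulerX C g + potential C π * g) =
    eulerX C (eulerAX C g + piAX C π * g) + potential C π * (eulerAX C g + piAX C π * g)
  rw [map_add, map_add, eulerAX_mul, eulerX_mul, eulerAX_eulerX, eulerAX_potential, eulerX_piAX]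
  ring

variable (b' b : ℝ)

/-- The derivation `a d/da` of `L(b')`. -/
def eulerL : Derivation C (L C p b') (L C p b') where
  toFun f := ⟨eulerA C (L.val C p f), eulerA_mem C p f.2⟩
  map_add' f g := Subtype.ext (by
    change eulerA C (L.val C p (f + g)) = _
    rw [map_add, map_add]; rfl)
  map_smul' c f := Subtype.ext (by
    change eulerA C (L.val C p (c • f)) = _
    rw [map_smul, Derivation.map_smul]; rfl)
  map_one_eq_zero' := Subtype.ext (by
    change eulerA C (L.val C p 1) = 0
    rw [map_one, Derivation.map_one_eq_zero])
  leibniz' f g := Subtype.ext (by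
    change eulerA C (L.val C p (f * g)) = _
    rw [map_mul, Derivation.leibniz]; rfl)

theorem val_eulerL (f : L C p b') : L.val C p (eulerL C p b' f) = eulerA C (L.val C p f) := rfl

/-- The image `D_a K(b', b)`. -/
def imDa : Submodule (L C p b') (SeriesAX C) :=
  (K C p b' b).map ((Da C π).restrictScalars (L C p b'))

theorem imDa_le_xK : imDa C p π b' b ≤ xK C p b' b := by
  rintro _ ⟨g, hg, rfl⟩
  exact ⟨Da_mem_K C p π hg, varX_dvd_Da C π g⟩

/-- The relative cohomology `M_a(b', b) = x K(b', b) / D_a K(b', b)`, an `L(b')`-module. -/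
abbrev Ma : Type := xK C p b' b ⧸ (imDa C p π b' b).submoduleOf (xK C p b' b)

/-- The operator `∂_a` on `x K(b', b)`. -/
def partialXK : xK C p b' b →ₗ[C] xK C p b' b where
  toFun g := ⟨partialA C π g, partialA_mem_xK C p π g.2⟩
  map_add' f g := Subtype.ext (by simp)
  map_smul' c g := Subtype.ext (by simp)

theorem partialXK_mem (g : xK C p b' b) (hg : g ∈ (imDa C p π b' b).submoduleOf (xK C p b' b)) :
    partialXK C p π b' b g ∈ (imDa C p π b' b).submoduleOf (xK C p b' b) := by
  obtain ⟨h, hh, e⟩ := hg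
  refine ⟨partialA C π h, partialA_mem_K C p π hh, ?_⟩
  change Da C π h = (g : SeriesAX C) at e
  change Da C π (partialA C π h) = partialA C π (g : SeriesAX C)
  rw [← e, partialA_Da]

/-- The operator `∂_a` on `M_a(b', b)`, induced by `∂_a` on `x K(b', b)`. -/
def partialMa : Ma C p π b' b →ₗ[C] Ma C p π b' b :=
  let N := (imDa C p π b' b).submoduleOf (xK C p b' b)
  let e := Submodule.Quotient.restrictScalarsEquiv C N
  e.toLinearMap ∘ₗ
    Submodule.mapQ (N.restrictScalars C) (N.restrictScalars C) (partialXK C p π b' b)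
      (fun g hg => partialXK_mem C p π b' b g hg) ∘ₗ
    e.symm.toLinearMap

theorem partialMa_mk (g : xK C p b' b) :
    partialMa C p π b' b (Submodule.Quotient.mk g) =
      Submodule.Quotient.mk (partialXK C p π b' b g) := rfl

theorem partialMa_smul (f : L C p b') (m : Ma C p π b' b) :
    partialMa C p π b' b (f • m) = eulerL C p b' f • m + f • partialMa C p π b' b m := by
  obtain ⟨g, rfl⟩ := Submodule.Quotient.mk_surjective _ m
  rw [← Submodule.Quotient.mk_smul, partialMa_mk, partialMa_mk, ← Submodule.Quotient.mk_smul,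
    ← Submodule.Quotient.mk_smul, ← Submodule.Quotient.mk_add]
  congr 1
  apply Subtype.ext
  change eulerAX C (f • (g : SeriesAX C)) + piAX C π * (f • (g : SeriesAX C)) =
    eulerL C p b' f • (g : SeriesAX C) + f • (eulerAX C (g : SeriesAX C) + piAX C π * (g : SeriesAX C))
  rw [L_smul_def, L_smul_def, L_smul_def, val_eulerL, eulerAX_mul, eulerAX_ofA]
  ring

/-- `M_a^(k)(b', b)`: the `k`-th symmetric power of `M_a(b', b)` over `L(b')`. -/
abbrev SymMa (k : ℕ) : Submodule (L C p b') (SymmetricAlgebra (L C p b') (Ma C p π b' b)) :=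
  symPow (L C p b') (Ma C p π b' b) k

/-- The operator `∂_a` on the `k`-th symmetric power of `M_a(b', b)` over `L(b')`. -/
def partialSym (k : ℕ) : SymMa C p π b' b k →ₗ[C] SymMa C p π b' b k :=
  symPowConnection (eulerL C p b') (partialMa C p π b' b) (partialMa_smul C p π b' b) k

/-- The cohomology space `H_k^0`: the kernel of `∂_a` on the `k`-th symmetric power of
`M_a(b', b)`. -/
def H0 (k : ℕ) : Submodule C (SymMa C p π b' b k) :=
  LinearMap.ker (partialSym C p π b' b k)

end Relative

end AiryCohomology

end

/-! Write `a = -3 s²`. In the basis `x, x²` the relative cohomology with its operator `∂_a` is the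
Airy system, `∂_a x = π a x²` and `∂_a x² = -(π/3) a² x`. Its formal solutions at infinity are
`s^(-1/2) exp(± 2 π s³)` times power series in `s⁻³`, and these power series converge for `|s| > 1`
(`norm_wkbB_le`: the factor `(6m-1)(6m+1)/(144 m π)` of their recursion has norm one on average).
So on a circle `|s| = r`, with `r` slightly larger than one, the system splits into two systems of
rank one. A horizontal element `u` of the `k`-th symmetric power has coefficients in `L(b')`, which
also converge on this circle, and becomes a form `∑ f_j X^(k-j) Y^j` whose coefficients are Laurent
series in `s`, infinite in both directions, with
`(2n - k) f_{j,n} = -12 π (k - 2j) f_{j,n-3}` for all integers `n`.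

If `p` does not divide `k - 2j`, a nonzero coefficient `f_{j,n}` makes `f_{j,n+3pᵉ}` decrease too
slowly for convergence on `|s| = r > 1`. If `p` divides `k - 2j` and `k` is odd, then `2n - k` never
vanishes, and a nonzero `f_{j,n}` makes `f_{j,n-3pᵉ}` grow at least like `p` to the
power `pᵉ`, too fast when `r³ < p`. Both cases are comparisons of
`∏ (A + d i)`, `i < pᵉ`, with `(pᵉ)!` (`norm_prod_progression_le`, `le_norm_prod_progression`). For `k` even with `k < 2p` the remaining
case is `k = 2j`, where `f_j = c s^(k/2)`. Then the coefficient of `(x²)^k` in `u` is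
`s^(-k/2)` times a power series in `s⁻³` whose constant term is a nonzero multiple of `c`.
It is also a power series in `s²`, so `c = 0`
(`eq_zero_of_balanced`).

That `x, x²` is a basis of the relative cohomology (`linearIndependent_powerClass`,
`span_powerClass`) is the fixed point statement for `shiftOp`: the iterates of this operator tend to
zero coefficient by coefficient, because each step either gains `b - 1/(p-1) > 0` in the valuation
or lowers the degree in `a`. -/

noncomputable section

namespace AiryCohomology

open Filter Topology

set_option linter.unusedSectionVars false

/-! ### A basis of the relative cohomology -/

section Relative

variable {C : Type} [NormedField C] [IsUltrametricDist C] {p : ℕ} [Fact p.Prime]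

theorem OrdGE.neg {c : C} {r : ℝ} (h : OrdGE p c r) : OrdGE p (-c) r := by
  unfold OrdGE at *; rwa [norm_neg]

theorem OrdGE.eq_zero {c : C} (h : ∀ r : ℝ, OrdGE p c r) : c = 0 := by
  have hp : (1 : ℝ) < p := by exact_mod_cast (Fact.out : p.Prime).one_lt
  by_contra hc
  obtain ⟨n, hn⟩ := exists_pow_lt_of_lt_one (norm_pos_iff.2 hc) (inv_lt_one_of_one_lt₀ hp)
  have := h n
  unfold OrdGE at this
  rw [Real.rpow_neg (by linarith), Real.rpow_natCast, ← inv_pow] at this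
  linarith

theorem OrdGE.tsum [CompleteSpace C] {ι : Type*} (f : ι → C) {r : ℝ} (h : ∀ i, OrdGE p (f i) r) :
    OrdGE p (∑' i, f i) r := by
  have hp : (0 : ℝ) < p := by exact_mod_cast (Fact.out : p.Prime).pos
  exact IsUltrametricDist.norm_tsum_le_of_forall_le_of_nonneg (by positivity) h

theorem OrdGE.summable [CompleteSpace C] (f : ℕ → C) (r ε : ℝ) (hε : 0 < ε)
    (h : ∀ n : ℕ, OrdGE p (f n) (ε * n + r)) : Summable f := by
  have hp : (1 : ℝ) < p := by exact_mod_cast (Fact.out : p.Prime).one_lt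
  refine NonarchimedeanAddGroup.summable_of_tendsto_cofinite_zero ?_
  rw [Nat.cofinite_eq_atTop]
  refine squeeze_zero_norm h ?_
  have : ∀ n : ℕ, (p : ℝ) ^ (-(ε * n + r)) = (p : ℝ) ^ (-r) * ((p : ℝ) ^ (-ε)) ^ n := fun n => by
    rw [← Real.rpow_natCast, ← Real.rpow_mul (by linarith), ← Real.rpow_add (by linarith)]
    ring_nf
  simp_rw [this]
  rw [← mul_zero ((p : ℝ) ^ (-r))]
  exact (tendsto_pow_atTop_nhds_zero_of_lt_one (by positivity)
    (Real.rpow_lt_one_of_one_lt_of_neg hp (by linarith))).const_mul _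

variable (π : C)

theorem coeffX_ofA_mul (f : SeriesA C) (g : SeriesAX C) (j : ℕ) :
    coeffX j (ofA C f * g) = f * coeffX j g :=
  PowerSeries.coeff_C_mul (R := SeriesA C) j g f

theorem coeffX_varX_mul (g : SeriesAX C) (j : ℕ) :
    coeffX (j + 1) (varX C * g) = coeffX j g :=
  PowerSeries.coeff_succ_X_mul (R := SeriesA C) j g

theorem Da_eq (g : SeriesAX C) : Da C π g = eulerX C g +
    (ofA C (PowerSeries.C (π * 3)) * (varX C * (varX C * (varX C * g))) +
      ofA C (PowerSeries.C π * PowerSeries.X) * (varX C * g)) := by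
  change eulerX C g + (ofA C (PowerSeries.C (π * 3)) * varX C ^ 3 +
    ofA C (PowerSeries.C π * PowerSeries.X) * varX C) * g = _
  ring

theorem coeffX_Da (g : SeriesAX C) (t : ℕ) :
    coeffX (t + 3) (Da C π g) = (((t + 3 : ℕ)) : SeriesA C) * coeffX (t + 3) g +
      (PowerSeries.C (π * 3) * coeffX t g +
        PowerSeries.C π * PowerSeries.X * coeffX (t + 2) g) := by
  rw [Da_eq, coeffX_add, coeffX_add, coeffX_eulerX, coeffX_ofA_mul, coeffX_ofA_mul,
    coeffX_varX_mul, coeffX_varX_mul, coeffX_varX_mul, coeffX_varX_mul]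

/-- The operator `h ↦ -(3π)⁻¹ ∑ₜ ((t + 3) h_{t+3} + π a h_{t+2}) xᵗ` on series `h = ∑ hₜ xᵗ`.
The coefficients of `xᵗ⁺³` in `D_a h` and in `g` agree for all `t` exactly when `h` is a fixed
point of `h ↦ (3π)⁻¹ ∑ g_{t+3} xᵗ + shiftOp h`. -/
def shiftOp (h : SeriesAX C) : SeriesAX C :=
  mkX fun t => PowerSeries.C (-(π * 3)⁻¹) * ((((t + 3 : ℕ)) : SeriesA C) * coeffX (t + 3) h +
    PowerSeries.C π * PowerSeries.X * coeffX (t + 2) h)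

theorem coeffX_shiftOp (h : SeriesAX C) (t : ℕ) : coeffX t (shiftOp π h) =
    PowerSeries.C (-(π * 3)⁻¹) * ((((t + 3 : ℕ)) : SeriesA C) * coeffX (t + 3) h +
    PowerSeries.C π * PowerSeries.X * coeffX (t + 2) h) := coeffX_mkX _ _

theorem coeff_shiftOp_zero (h : SeriesAX C) (t : ℕ) :
    PowerSeries.coeff 0 (coeffX t (shiftOp π h)) =
      -(π * 3)⁻¹ * ((t + 3 : ℕ) * PowerSeries.coeff 0 (coeffX (t + 3) h)) := by
  have e : (((t + 3 : ℕ) : SeriesA C)) = PowerSeries.C ((t + 3 : ℕ) : C) :=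
    (map_natCast PowerSeries.C _).symm
  rw [coeffX_shiftOp, PowerSeries.coeff_C_mul, map_add, e, PowerSeries.coeff_C_mul, mul_assoc,
    PowerSeries.coeff_C_mul, PowerSeries.coeff_zero_X_mul, mul_zero, add_zero]

theorem coeff_shiftOp_succ (h : SeriesAX C) (t i : ℕ) :
    PowerSeries.coeff (i + 1) (coeffX t (shiftOp π h)) =
      -(π * 3)⁻¹ * ((t + 3 : ℕ) * PowerSeries.coeff (i + 1) (coeffX (t + 3) h) +
        π * PowerSeries.coeff i (coeffX (t + 2) h)) := by
  have e : (((t + 3 : ℕ) : SeriesA C)) = PowerSeries.C ((t + 3 : ℕ) : C) :=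
    (map_natCast PowerSeries.C _).symm
  rw [coeffX_shiftOp, PowerSeries.coeff_C_mul, map_add, e, PowerSeries.coeff_C_mul, mul_assoc,
    PowerSeries.coeff_C_mul, PowerSeries.coeff_succ_X_mul]

/-- The bound `ord(Bᵢⱼ) ≥ (2/3) b' i + b j / 3 + ρ + ε (n - i)` on the coefficients of a series.
For `ε > 0` it expresses that the terms of a fixed degree in `a` become small as `n` grows. -/
def ShiftBound (p : ℕ) (b' b ρ ε n : ℝ) (g : SeriesAX C) : Prop :=
  ∀ i j : ℕ, OrdGE p (PowerSeries.coeff i (coeffX j g))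
    (b' * (1 - 1 / 3) * i + b * j / 3 + ρ + ε * (n - i))

theorem shiftBound_shiftOp {b' b β ρ ε n : ℝ} {g : SeriesAX C} (hπ : π ≠ 0)
    (h1 : OrdGE p (π * 3)⁻¹ (-β)) (h3 : OrdGE p (3 : C)⁻¹ 0) (hb : b' ≤ b)
    (hε : ε ≤ b - β) (hg : ShiftBound p b' b ρ ε n g) :
    ShiftBound p b' b ρ ε (n + 1) (shiftOp π g) := by
  have key : ∀ i j : ℕ, OrdGE p (-(π * 3)⁻¹ * ((j + 3 : ℕ) *
      PowerSeries.coeff i (coeffX (j + 3) g)))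
      (b' * (1 - 1 / 3) * i + b * j / 3 + ρ + ε * (n + 1 - i)) := fun i j => by
    refine (h1.neg.mul ((OrdGE.natCast _).mul (hg i (j + 3)))).mono ?_
    push_cast
    linarith
  intro i j
  cases i with
  | zero => rw [coeff_shiftOp_zero]; exact key 0 j
  | succ i =>
    rw [coeff_shiftOp_succ, mul_add]
    refine (key _ j).add ?_
    have e : -(π * 3)⁻¹ * (π * PowerSeries.coeff i (coeffX (j + 2) g)) =
        -(3 : C)⁻¹ * PowerSeries.coeff i (coeffX (j + 2) g) := by
      rw [mul_inv, ← mul_assoc]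
      congr 1
      field_simp
    rw [e]
    refine (h3.neg.mul (hg i (j + 2))).mono ?_
    push_cast
    linarith

theorem shiftBound_iterate {b' b β ρ ε : ℝ} {g : SeriesAX C} (hπ : π ≠ 0)
    (h1 : OrdGE p (π * 3)⁻¹ (-β)) (h3 : OrdGE p (3 : C)⁻¹ 0) (hb : b' ≤ b)
    (hε : ε ≤ b - β) (hg : ShiftBound p b' b ρ ε 0 g) (n : ℕ) :
    ShiftBound p b' b ρ ε n ((shiftOp π)^[n] g) := by
  induction n with
  | zero => simpa using hg
  | succ n ih =>
    rw [Function.iterate_succ_apply', Nat.cast_succ]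
    exact shiftBound_shiftOp π hπ h1 h3 hb hε ih

theorem KRho.shiftBound_zero {b' b ρ n : ℝ} {g : SeriesAX C} :
    ShiftBound p b' b ρ 0 n g ↔ g ∈ KRho C p b' b ρ := by
  unfold ShiftBound KRho
  simp

theorem KRho.shiftBound {b' b ρ ε : ℝ} (hε : 0 ≤ ε) {g : SeriesAX C}
    (hg : g ∈ KRho C p b' b ρ) : ShiftBound p b' b ρ ε 0 g := fun i j =>
  (hg i j).mono (by nlinarith [(Nat.cast_nonneg i : (0 : ℝ) ≤ i)])

/-- A series in `K(b', b)` that is fixed by `shiftOp` vanishes. -/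
theorem eq_zero_of_shiftOp_eq {b' b β : ℝ} {g : SeriesAX C} (hπ : π ≠ 0)
    (h1 : OrdGE p (π * 3)⁻¹ (-β)) (h3 : OrdGE p (3 : C)⁻¹ 0) (hb : b' ≤ b)
    (hβ : β < b) (hg : g ∈ K C p b' b) (e : shiftOp π g = g) : g = 0 := by
  obtain ⟨ρ, hg⟩ := hg
  have hit : ∀ n : ℕ, (shiftOp π)^[n] g = g := fun n => Function.iterate_fixed e n
  refine seriesAX_ext fun j => ?_
  ext i
  rw [coeffX_zero, map_zero]
  refine OrdGE.eq_zero (p := p) fun r => ?_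
  have hε : 0 < b - β := by linarith
  obtain ⟨n, hn⟩ := exists_nat_ge
    ((r - (b' * (1 - 1 / 3) * i + b * j / 3 + ρ)) / (b - β) + i)
  have := shiftBound_iterate π hπ h1 h3 hb le_rfl (KRho.shiftBound hε.le hg) n i j
  rw [hit] at this
  refine this.mono ?_
  have h2 : (r - (b' * (1 - 1 / 3) * i + b * j / 3 + ρ)) / (b - β) ≤ n - i := by linarith
  rw [div_le_iff₀ hε] at h2
  nlinarith

/-- For `g` in `K(b', b)` the equation `h = g + shiftOp h` has a solution in `K(b', b)`. -/
theorem exists_eq_add_shiftOp [CompleteSpace C] {b' b β : ℝ} {g : SeriesAX C} (hπ : π ≠ 0)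
    (h1 : OrdGE p (π * 3)⁻¹ (-β)) (h3 : OrdGE p (3 : C)⁻¹ 0) (hb : b' ≤ b)
    (hβ : β < b) (hg : g ∈ K C p b' b) : ∃ h ∈ K C p b' b, h = g + shiftOp π h := by
  obtain ⟨ρ, hg⟩ := hg
  have hε : 0 < b - β := by linarith
  let c : ℕ → ℕ → ℕ → C := fun i j n => PowerSeries.coeff i (coeffX j ((shiftOp π)^[n] g))
  have hs : ∀ i j, Summable (c i j) := fun i j => by
    refine OrdGE.summable (p := p) _
      (b' * (1 - 1 / 3) * i + b * j / 3 + ρ - (b - β) * i) (b - β) hε fun n => ?_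
    refine (shiftBound_iterate π hπ h1 h3 hb le_rfl (KRho.shiftBound hε.le hg) n i j).mono ?_
    linarith
  let h : SeriesAX C := mkX fun j => PowerSeries.mk fun i => ∑' n, c i j n
  have hc : ∀ i j, PowerSeries.coeff i (coeffX j h) = ∑' n, c i j n := fun i j => by
    rw [coeffX_mkX, PowerSeries.coeff_mk]
  refine ⟨h, ⟨ρ, fun i j => ?_⟩, seriesAX_ext fun j => ?_⟩
  · rw [hc]
    refine OrdGE.tsum _ fun n => ?_
    exact (KRho.shiftBound_zero.1 (shiftBound_iterate π hπ h1 h3 hb hε.le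
      (KRho.shiftBound_zero.2 hg) n)) i j
  · ext i
    rw [coeffX_add, map_add, hc, (hs i j).tsum_eq_zero_add]
    congr 1
    cases i with
    | zero =>
      rw [coeff_shiftOp_zero, hc, ← tsum_mul_left, ← tsum_mul_left]
      refine tsum_congr fun n => ?_
      change PowerSeries.coeff 0 (coeffX j ((shiftOp π)^[n + 1] g)) = _
      rw [Function.iterate_succ_apply', coeff_shiftOp_zero]
    | succ i =>
      rw [coeff_shiftOp_succ, hc, hc, ← tsum_mul_left, ← tsum_mul_left,
        ← ((hs _ _).mul_left _).tsum_add ((hs _ _).mul_left _), ← tsum_mul_left]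
      refine tsum_congr fun n => ?_
      change PowerSeries.coeff (i + 1) (coeffX j ((shiftOp π)^[n + 1] g)) = _
      rw [Function.iterate_succ_apply', coeff_shiftOp_succ]

theorem coeffX_mem_LSub {b' b : ℝ} {g : SeriesAX C} (hg : g ∈ K C p b' b) (j : ℕ) :
    coeffX j g ∈ LSub C p b' := by
  obtain ⟨ρ, hg⟩ := hg
  exact ⟨b * j / 3 + ρ, fun i => (hg i j).mono (by linarith)⟩

/-- Every element of `K(b', b)` is congruent modulo `D_a K(b', b)` to an element of `K(b', b)` of
degree at most two in `x`. -/
theorem exists_sub_Da [CompleteSpace C] {b' b β : ℝ} {g : SeriesAX C} (hπ : π ≠ 0)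
    (h30 : (3 : C) ≠ 0)
    (h1 : OrdGE p (π * 3)⁻¹ (-β)) (h3 : OrdGE p (3 : C)⁻¹ 0) (hb : b' ≤ b)
    (hβ : β < b) (hg : g ∈ K C p b' b) :
    ∃ h ∈ K C p b' b, ∀ t, coeffX (t + 3) (g - Da C π h) = 0 := by
  have hπ3 : π * 3 ≠ 0 := mul_ne_zero hπ h30
  let g0 : SeriesAX C := mkX fun t => PowerSeries.C (π * 3)⁻¹ * coeffX (t + 3) g
  have hg0 : g0 ∈ K C p b' b := by
    obtain ⟨ρ, hg⟩ := hg
    refine ⟨ρ - β + b, fun i j => ?_⟩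
    rw [coeffX_mkX, PowerSeries.coeff_C_mul]
    refine (h1.mul (hg i (j + 3))).mono ?_
    push_cast
    linarith
  obtain ⟨h, hh, e⟩ := exists_eq_add_shiftOp π hπ h1 h3 hb hβ hg0
  refine ⟨h, hh, fun t => ?_⟩
  have e' := congrArg (coeffX t) e
  rw [coeffX_add, coeffX_mkX, coeffX_shiftOp] at e'
  have hC : PowerSeries.C (π * 3) * PowerSeries.C (π * 3)⁻¹ = (1 : SeriesA C) := by
    rw [← map_mul, mul_inv_cancel₀ hπ3, map_one]
  have hD := coeffX_Da π h t
  have hsub : coeffX (t + 3) (g - Da C π h) = coeffX (t + 3) g - coeffX (t + 3) (Da C π h) :=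
    map_sub (PowerSeries.coeff (R := SeriesA C) (t + 3)) g (Da C π h)
  rw [hsub, hD, e', map_neg]
  linear_combination (-coeffX (t + 3) g + (((t + 3 : ℕ)) : SeriesA C) * coeffX (t + 3) h +
      PowerSeries.C π * PowerSeries.X * coeffX (t + 2) h) * hC

/-- An element of `D_a K(b', b)` of degree at most two in `x` vanishes. -/
theorem Da_eq_zero {b' b β : ℝ} {h : SeriesAX C} (hπ : π ≠ 0)
    (h30 : (3 : C) ≠ 0)
    (h1 : OrdGE p (π * 3)⁻¹ (-β)) (h3 : OrdGE p (3 : C)⁻¹ 0) (hb : b' ≤ b)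
    (hβ : β < b) (hh : h ∈ K C p b' b) (e : ∀ t, coeffX (t + 3) (Da C π h) = 0) :
    Da C π h = 0 := by
  have hπ3 : π * 3 ≠ 0 := mul_ne_zero hπ h30
  have hC : PowerSeries.C (π * 3) * PowerSeries.C (π * 3)⁻¹ = (1 : SeriesA C) := by
    rw [← map_mul, mul_inv_cancel₀ hπ3, map_one]
  have : h = 0 := eq_zero_of_shiftOp_eq π hπ h1 h3 hb hβ hh <| seriesAX_ext fun t => by
    have := e t
    rw [coeffX_Da] at this
    rw [coeffX_shiftOp, map_neg]
    linear_combination -PowerSeries.C (π * 3)⁻¹ * this + coeffX t h * hC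
  rw [this, map_zero]

theorem varX_pow_mem_xK (b' b : ℝ) (n : ℕ) (hn : n ≠ 0) : varX C ^ n ∈ xK C p b' b :=
  ⟨⟨_, KRho_varX_pow b' b n⟩, dvd_pow_self _ hn⟩

variable (p) in
/-- The classes of `x` and `x ^ 2` in `M_a(b', b)`. -/
def powerClass (b' b : ℝ) (j : Fin 2) : Ma C p π b' b :=
  Submodule.Quotient.mk ⟨varX C ^ (j.1 + 1), varX_pow_mem_xK b' b (j.1 + 1) j.1.succ_ne_zero⟩

theorem coeffX_smul_varX_pow {b' : ℝ} (f : L C p b') (n j : ℕ) :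
    coeffX j (f • varX C ^ n) = if j = n then L.val C p f else 0 := by
  rw [L_smul_def, coeffX_ofA_mul, coeffX_varX_pow]
  split_ifs <;> simp

theorem linearIndependent_powerClass {b' b β : ℝ} (hπ : π ≠ 0) (h30 : (3 : C) ≠ 0)
    (h1 : OrdGE p (π * 3)⁻¹ (-β)) (h3 : OrdGE p (3 : C)⁻¹ 0) (hb : b' ≤ b) (hβ : β < b) :
    LinearIndependent (L C p b') (powerClass p π b' b) := by
  rw [Fintype.linearIndependent_iff]
  intro f hf
  have hf' : (Submodule.Quotient.mk
      (∑ j : Fin 2, f j • (⟨varX C ^ (j.1 + 1),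
        varX_pow_mem_xK b' b (j.1 + 1) j.1.succ_ne_zero⟩ : xK C p b' b)) : Ma C p π b' b) = 0 := by
    rw [← hf, ← Submodule.mkQ_apply, map_sum]
    rfl
  rw [Submodule.Quotient.mk_eq_zero] at hf'
  obtain ⟨h, hh, e⟩ := hf'
  replace e : Da C π h = f 0 • varX C ^ 1 + f 1 • varX C ^ 2 := by
    refine e.trans ?_
    simp
  have h0 := Da_eq_zero π hπ h30 h1 h3 hb hβ hh fun t => by
    rw [e, coeffX_add, coeffX_smul_varX_pow, coeffX_smul_varX_pow, if_neg (by omega),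
      if_neg (by omega), add_zero]
  rw [h0] at e
  have inj : Function.Injective (L.val C p (b' := b')) := Subtype.val_injective
  have c1 := congrArg (coeffX 1) e
  have c2 := congrArg (coeffX 2) e
  rw [coeffX_add, coeffX_smul_varX_pow, coeffX_smul_varX_pow, coeffX_zero] at c1 c2
  intro j
  apply inj
  rw [map_zero]
  fin_cases j
  · simpa using c1.symm
  · simpa using c2.symm

theorem span_powerClass [CompleteSpace C] {b' b β : ℝ} (hπ : π ≠ 0) (h30 : (3 : C) ≠ 0)
    (h1 : OrdGE p (π * 3)⁻¹ (-β)) (h3 : OrdGE p (3 : C)⁻¹ 0) (hb : b' ≤ b) (hβ : β < b) :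
    ⊤ ≤ Submodule.span (L C p b') (Set.range (powerClass p π b' b)) := by
  rintro m -
  obtain ⟨g, rfl⟩ := Submodule.Quotient.mk_surjective _ m
  obtain ⟨h, hh, e⟩ := exists_sub_Da π hπ h30 h1 h3 hb hβ g.2.1
  have hr : (g : SeriesAX C) - Da C π h ∈ xK C p b' b :=
    Submodule.sub_mem _ g.2 ⟨Da_mem_K C p π hh, varX_dvd_Da C π h⟩
  let f : ℕ → L C p b' := fun j => ⟨_, coeffX_mem_LSub hr.1 j⟩
  have hg : (Submodule.Quotient.mk g : Ma C p π b' b) =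
      f 1 • powerClass p π b' b 0 + f 2 • powerClass p π b' b 1 := by
    change _ = Submodule.Quotient.mk (f 1 • (⟨varX C ^ 1, _⟩ : xK C p b' b) +
      f 2 • (⟨varX C ^ 2, _⟩ : xK C p b' b))
    rw [Submodule.Quotient.eq]
    refine ⟨h, hh, ?_⟩
    change Da C π h = (g : SeriesAX C) - (f 1 • varX C ^ 1 + f 2 • varX C ^ 2)
    rw [eq_sub_iff_add_eq, add_comm, ← eq_sub_iff_add_eq]
    refine seriesAX_ext fun j => ?_
    rw [coeffX_add, coeffX_smul_varX_pow, coeffX_smul_varX_pow]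
    match j with
    | 0 => simpa using ((varX_dvd_iff C _).1 hr.2).symm
    | 1 => simp only [if_true]; rw [if_neg (by norm_num), add_zero]; rfl
    | 2 => simp only [if_true]; rw [if_neg (by norm_num), zero_add]; rfl
    | t + 3 => rw [e, if_neg (by omega), if_neg (by omega), add_zero]
  rw [hg]
  exact Submodule.add_mem _ (Submodule.smul_mem _ _ (Submodule.subset_span ⟨0, rfl⟩))
    (Submodule.smul_mem _ _ (Submodule.subset_span ⟨1, rfl⟩))

/-- The element `a` of `L(b')`. -/
def L.a (C : Type) [NormedField C] [IsUltrametricDist C] (p : ℕ) [Fact p.Prime] (b' : ℝ) :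
    L C p b' := ⟨PowerSeries.X, _, LRho_X b'⟩

theorem partialMa_powerClass_zero (b' b : ℝ) : partialMa C p π b' b (powerClass p π b' b 0) =
    (algebraMap C (L C p b') π * L.a C p b') • powerClass p π b' b 1 := by
  change Submodule.Quotient.mk _ = Submodule.Quotient.mk _
  congr 1
  apply Subtype.ext
  change eulerAX C (varX C ^ 1) + piAX C π * varX C ^ 1 =
    (algebraMap C (L C p b') π * L.a C p b') • varX C ^ 2
  have e : L.val C p (algebraMap C (L C p b') π * L.a C p b') =
      PowerSeries.C π * PowerSeries.X := rfl
  rw [eulerAX_varX_pow, L_smul_def, piAX, e]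
  ring

theorem partialMa_powerClass_one (b' b : ℝ) (h30 : (3 : C) ≠ 0) :
    partialMa C p π b' b (powerClass p π b' b 1) =
    (algebraMap C (L C p b') (-π / 3) * L.a C p b' ^ 2) • powerClass p π b' b 0 := by
  change Submodule.Quotient.mk _ = Submodule.Quotient.mk _
  rw [Submodule.Quotient.eq]
  refine ⟨(algebraMap C (L C p b') (1 / 3) * L.a C p b') • varX C ^ 0,
    Submodule.smul_mem _ _ ⟨_, KRho_varX_pow b' b 0⟩, ?_⟩
  change Da C π _ = (eulerAX C (varX C ^ 2) + piAX C π * varX C ^ 2) -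
    (algebraMap C (L C p b') (-π / 3) * L.a C p b' ^ 2) • varX C ^ 1
  rw [eulerAX_varX_pow, L_smul_def, L_smul_def, piAX, Da_eq]
  have e1 : L.val C p (L.a C p b') = PowerSeries.X := rfl
  have e2 : ∀ c, L.val C p (algebraMap C (L C p b') c) = PowerSeries.C c := fun c => rfl
  have h3 : ofA C (PowerSeries.C (π * 3)) * ofA C (PowerSeries.C (1 / 3)) =
      ofA C (PowerSeries.C π) := by
    rw [← map_mul, ← map_mul]; congr 2; field_simp
  have h4 : ofA C (PowerSeries.C π) * ofA C (PowerSeries.C (1 / 3)) =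
      - ofA C (PowerSeries.C (-π / 3)) := by
    rw [← map_mul, ← map_mul, ← map_neg, ← map_neg]; congr 2; ring
  rw [eulerX_mul, pow_zero, eulerX_ofA]
  have h5 : eulerX C 1 = 0 := by rw [← map_one (ofA C), eulerX_ofA]
  rw [h5]
  simp only [map_mul (L.val C p), map_pow (L.val C p), e1, e2]
  simp only [map_mul (ofA C) (PowerSeries.C π), map_mul (ofA C) (PowerSeries.C (1 / 3)),
    map_mul (ofA C) (PowerSeries.C (-π / 3)), map_pow (ofA C)]
  linear_combination ofA C PowerSeries.X * varX C ^ 3 * (h3) + ofA C PowerSeries.X ^ 2 * varX C * h4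

end Relative

/-! ### Laurent series on a circle -/

section CircleSeries

variable (C : Type) [NormedField C] [IsUltrametricDist C] [CompleteSpace C]
  (r : ℝ) [hr : Fact (0 < r)]

/-- The families `(fₙ)` indexed by the integers with `‖fₙ‖ rⁿ → 0` in both directions. -/
def circleSubmodule : Submodule C (ℤ → C) where
  carrier := {f | Tendsto (fun n => ‖f n‖ * r ^ n) cofinite (𝓝 0)}
  zero_mem' := by simp
  add_mem' := by
    intro f g hf hg
    have hr := hr.out
    refine squeeze_zero (fun n => by positivity) (fun n => ?_)
      (by simpa using Tendsto.add hf hg)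
    rw [← add_mul]
    exact mul_le_mul_of_nonneg_right (norm_add_le _ _) (by positivity)
  smul_mem' := by
    intro c f hf
    refine Tendsto.congr (fun n => ?_) (by simpa using Tendsto.const_mul ‖c‖ hf)
    simp [mul_assoc]

/-- The ring of Laurent series `∑ fₙ sⁿ` in both directions that converge on the circle `|s| = r`,
with the product of series. -/
def CircleSeries : Type := circleSubmodule C r

instance : AddCommGroup (CircleSeries C r) := inferInstanceAs (AddCommGroup (circleSubmodule C r))

variable {C r}

namespace CircleSeries

/-- The coefficient of `sⁿ`. -/
def coeff (f : CircleSeries C r) (n : ℤ) : C := f.1 n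

@[ext] theorem ext {f g : CircleSeries C r} (h : ∀ n, f.coeff n = g.coeff n) : f = g :=
  Subtype.ext (funext h)

@[simp] theorem coeff_add (f g : CircleSeries C r) (n : ℤ) :
    (f + g).coeff n = f.coeff n + g.coeff n := rfl
@[simp] theorem coeff_neg (f : CircleSeries C r) (n : ℤ) : (-f).coeff n = -f.coeff n := rfl
@[simp] theorem coeff_sub (f g : CircleSeries C r) (n : ℤ) :
    (f - g).coeff n = f.coeff n - g.coeff n := rfl
@[simp] theorem coeff_zero (n : ℤ) : (0 : CircleSeries C r).coeff n = 0 := rfl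

theorem tendsto (f : CircleSeries C r) :
    Tendsto (fun n => ‖f.coeff n‖ * r ^ n) cofinite (𝓝 0) := f.2

theorem tendsto_mul (f g : CircleSeries C r) :
    Tendsto (fun x : ℤ × ℤ => ‖f.coeff x.1 * g.coeff x.2‖ * r ^ (x.1 + x.2)) cofinite (𝓝 0) := by
  refine (tendsto_mul_cofinite_nhds_zero f.tendsto g.tendsto).congr fun x => ?_
  rw [norm_mul, zpow_add₀ hr.out.ne']
  ring

theorem tendsto_mul_mul (f g h : CircleSeries C r) :
    Tendsto (fun x : (ℤ × ℤ) × ℤ => ‖f.coeff x.1.1 * g.coeff x.1.2 * h.coeff x.2‖ *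
      r ^ (x.1.1 + x.1.2 + x.2)) cofinite (𝓝 0) := by
  refine (tendsto_mul_cofinite_nhds_zero (tendsto_mul f g) h.tendsto).congr fun x => ?_
  rw [norm_mul _ (h.coeff _), zpow_add₀ hr.out.ne' (x.1.1 + x.1.2)]
  ring

theorem summable_of_weight {ι : Type*} (u : ι → C) (n : ℤ)
    (h : Tendsto (fun i => ‖u i‖ * r ^ n) cofinite (𝓝 0)) : Summable u := by
  have hr := hr.out
  refine NonarchimedeanAddGroup.summable_of_tendsto_cofinite_zero ?_
  rw [tendsto_zero_iff_norm_tendsto_zero]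
  refine Tendsto.congr (fun i => ?_) (by simpa using h.mul_const (r ^ n)⁻¹)
  field_simp

theorem summable_mul (f g : CircleSeries C r) (n : ℤ) :
    Summable fun m => f.coeff m * g.coeff (n - m) := by
  refine summable_of_weight (r := r) _ n ?_
  have inj : Function.Injective fun m : ℤ => (m, n - m) := fun a b h => (Prod.ext_iff.1 h).1
  refine ((tendsto_mul f g).comp inj.tendsto_cofinite).congr fun m => ?_
  simp

instance : Mul (CircleSeries C r) where
  mul f g := ⟨fun n => ∑' m, f.coeff m * g.coeff (n - m), by
    have hr := hr.out
    change Tendsto (fun n => ‖∑' m, f.coeff m * g.coeff (n - m)‖ * r ^ n) cofinite (𝓝 0)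
    rw [Metric.tendsto_nhds]
    intro ε hε
    have h := (Metric.tendsto_nhds.1 (tendsto_mul f g)) (ε / 2) (half_pos hε)
    rw [eventually_cofinite] at h ⊢
    refine (h.image fun x => x.1 + x.2).subset fun n hn => ?_
    by_contra hc
    apply hn
    have : ‖∑' m, f.coeff m * g.coeff (n - m)‖ ≤ ε / 2 * (r ^ n)⁻¹ := by
      refine IsUltrametricDist.norm_tsum_le_of_forall_le_of_nonneg (by positivity) fun m => ?_
      by_contra hm
      refine hc ⟨(m, n - m), fun hlt => hm ?_, by simp⟩
      rw [dist_zero_right, Real.norm_of_nonneg (by positivity)] at hlt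
      simp only [add_sub_cancel] at hlt
      rw [← div_eq_mul_inv, le_div_iff₀ (by positivity)]
      exact hlt.le
    rw [dist_zero_right, Real.norm_of_nonneg (by positivity)]
    rw [← div_eq_mul_inv, le_div_iff₀ (by positivity)] at this
    linarith⟩

theorem coeff_mul (f g : CircleSeries C r) (n : ℤ) :
    (f * g).coeff n = ∑' m, f.coeff m * g.coeff (n - m) := rfl

theorem single_mem (j : ℤ) (c : C) : Pi.single j c ∈ circleSubmodule C r := by
  change Tendsto (fun n => ‖(Pi.single j c : ℤ → C) n‖ * r ^ n) cofinite (𝓝 0)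
  refine tendsto_const_nhds.congr' ?_
  rw [EventuallyEq, eventually_cofinite]
  refine (Set.finite_singleton j).subset fun n hn => ?_
  by_contra h
  apply hn
  rw [Pi.single_eq_of_ne h, norm_zero, zero_mul]

variable (r) in
/-- The monomial `c sʲ`. -/
def mon (j : ℤ) (c : C) : CircleSeries C r := ⟨Pi.single j c, single_mem j c⟩

theorem coeff_mon (j : ℤ) (c : C) (n : ℤ) : (mon r j c).coeff n = if n = j then c else 0 :=
  Pi.single_apply _ _ _

theorem coeff_mon_mul (j : ℤ) (c : C) (f : CircleSeries C r) (n : ℤ) :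
    (mon r j c * f).coeff n = c * f.coeff (n - j) := by
  rw [coeff_mul, tsum_eq_single j fun m hm => by rw [coeff_mon, if_neg hm, zero_mul],
    coeff_mon, if_pos rfl]

theorem mul_comm' (f g : CircleSeries C r) : f * g = g * f := by
  ext n
  rw [coeff_mul, coeff_mul, ← (Equiv.subLeft n).tsum_eq]
  refine tsum_congr fun m => ?_
  rw [Equiv.subLeft_apply, sub_sub_cancel, _root_.mul_comm]

theorem mul_assoc' (f g h : CircleSeries C r) : f * g * h = f * (g * h) := by
  ext n
  have inj : Function.Injective fun x : ℤ × ℤ => ((x.1, x.2), n - x.1 - x.2) :=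
    fun a b h => (Prod.ext_iff.1 h).1
  have hs : Summable fun x : ℤ × ℤ => f.coeff x.1 * g.coeff x.2 * h.coeff (n - x.1 - x.2) := by
    refine summable_of_weight (r := r) _ n ?_
    refine ((tendsto_mul_mul f g h).comp inj.tendsto_cofinite).congr fun x => ?_
    simp only [Function.comp]
    congr 2
    ring
  let e : ℤ × ℤ ≃ ℤ × ℤ :=
    { toFun := fun x => (x.2, x.1 - x.2)
      invFun := fun x => (x.1 + x.2, x.1)
      left_inv := fun x => by simp
      right_inv := fun x => by simp }
  calc (f * g * h).coeff n
      = ∑' t, ∑' m, f.coeff m * g.coeff (t - m) * h.coeff (n - t) := by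
        rw [coeff_mul]
        refine tsum_congr fun t => ?_
        rw [coeff_mul, tsum_mul_right]
    _ = ∑' x : ℤ × ℤ, f.coeff x.2 * g.coeff (x.1 - x.2) * h.coeff (n - x.1) := by
        refine (Summable.tsum_prod (f := fun x : ℤ × ℤ =>
          f.coeff x.2 * g.coeff (x.1 - x.2) * h.coeff (n - x.1)) ?_).symm
        refine (e.summable_iff.2 hs).congr fun x => ?_
        simp [e]
    _ = ∑' x : ℤ × ℤ, f.coeff x.1 * g.coeff x.2 * h.coeff (n - x.1 - x.2) := by
        rw [← e.tsum_eq fun x : ℤ × ℤ => f.coeff x.1 * g.coeff x.2 * h.coeff (n - x.1 - x.2)]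
        refine tsum_congr fun x => ?_
        simp [e]
    _ = ∑' m, ∑' l, f.coeff m * g.coeff l * h.coeff (n - m - l) :=
        Summable.tsum_prod (f := fun x : ℤ × ℤ =>
          f.coeff x.1 * g.coeff x.2 * h.coeff (n - x.1 - x.2)) hs
    _ = (f * (g * h)).coeff n := by
        rw [coeff_mul]
        refine tsum_congr fun m => ?_
        rw [coeff_mul, ← tsum_mul_left]
        refine tsum_congr fun l => ?_
        rw [_root_.mul_assoc]

theorem mul_add' (f g h : CircleSeries C r) : f * (g + h) = f * g + f * h := by
  ext n
  rw [coeff_add, coeff_mul, coeff_mul, coeff_mul,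
    ← (summable_mul f g n).tsum_add (summable_mul f h n)]
  refine tsum_congr fun m => ?_
  rw [coeff_add, mul_add]

theorem one_mul' (f : CircleSeries C r) : mon r 0 1 * f = f := by
  ext n
  rw [coeff_mon_mul, one_mul, sub_zero]

instance : CommRing (CircleSeries C r) where
  __ := (inferInstance : AddCommGroup (CircleSeries C r))
  mul := (· * ·)
  one := mon r 0 1
  mul_comm := mul_comm'
  mul_assoc := mul_assoc'
  one_mul := one_mul'
  mul_one f := by rw [mul_comm']; exact one_mul' f
  zero_mul f := by ext n; rw [coeff_mul]; simp
  mul_zero f := by ext n; rw [coeff_mul]; simp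
  left_distrib := mul_add'
  right_distrib f g h := by rw [mul_comm', mul_add', mul_comm' h, mul_comm' h]

theorem one_def : (1 : CircleSeries C r) = mon r 0 1 := rfl

theorem mon_mul_mon (j l : ℤ) (c d : C) : mon r j c * mon r l d = mon r (j + l) (c * d) := by
  ext n
  rw [coeff_mon_mul, coeff_mon, coeff_mon]
  by_cases h : n = j + l
  · rw [if_pos h, if_pos (by omega)]
  · rw [if_neg h, if_neg (by omega), mul_zero]

theorem mon_add (j : ℤ) (c d : C) : mon r j (c + d) = mon r j c + mon r j d := by
  ext n
  rw [coeff_add, coeff_mon, coeff_mon, coeff_mon]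
  split_ifs <;> simp

/-- The derivation `s d/ds`. -/
def euler : CircleSeries C r →+ CircleSeries C r where
  toFun f := ⟨fun n => n * f.coeff n, by
    have hr := hr.out
    refine squeeze_zero (fun n => by positivity) (fun n => ?_) f.tendsto
    refine mul_le_mul_of_nonneg_right ?_ (by positivity)
    rw [norm_mul]
    exact mul_le_of_le_one_left (norm_nonneg _) (IsUltrametricDist.norm_intCast_le_one C n)⟩
  map_zero' := by ext n; change (n : C) * 0 = 0; simp
  map_add' f g := by
    ext n
    change (n : C) * (f.coeff n + g.coeff n) = n * f.coeff n + n * g.coeff n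
    ring

@[simp] theorem coeff_euler (f : CircleSeries C r) (n : ℤ) : (euler f).coeff n = n * f.coeff n := rfl

theorem euler_mul (f g : CircleSeries C r) : euler (f * g) = euler f * g + f * euler g := by
  ext n
  rw [coeff_euler, coeff_add, coeff_mul, coeff_mul, coeff_mul, ← tsum_mul_left,
    ← (summable_mul _ _ n).tsum_add (summable_mul _ _ n)]
  refine tsum_congr fun m => ?_
  rw [coeff_euler, coeff_euler]
  push_cast
  ring

/-- The series `∑ₘ uₘ s^(dm)` for a sequence `u`, as a family indexed by the integers. -/
def spread (d : ℤ) (u : ℕ → C) : ℤ → C := Function.extend (fun m : ℕ => d * (m : ℤ)) u 0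

theorem injective_spread {d : ℤ} (hd : d ≠ 0) : Function.Injective fun m : ℕ => d * (m : ℤ) :=
  fun a b h => by exact_mod_cast mul_left_cancel₀ hd h

theorem spread_apply {d : ℤ} (hd : d ≠ 0) (u : ℕ → C) (m : ℕ) : spread d u (d * m) = u m :=
  (injective_spread hd).extend_apply u 0 m

theorem spread_eq_zero {d : ℤ} (u : ℕ → C) (n : ℤ) (h : ∀ m : ℕ, n ≠ d * m) :
    spread d u n = 0 :=
  Function.extend_apply' _ _ _ fun ⟨m, hm⟩ => h m hm.symm

theorem spread_mem {d : ℤ} (hd : d ≠ 0) {u : ℕ → C}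
    (h : Tendsto (fun m : ℕ => ‖u m‖ * r ^ (d * m)) atTop (𝓝 0)) :
    spread d u ∈ circleSubmodule C r := by
  have hr := hr.out
  change Tendsto (fun n => ‖spread d u n‖ * r ^ n) cofinite (𝓝 0)
  rw [← Nat.cofinite_eq_atTop] at h
  rw [Metric.tendsto_nhds] at h ⊢
  intro ε hε
  have h' := h ε hε
  rw [eventually_cofinite] at h' ⊢
  refine (h'.image fun m : ℕ => d * (m : ℤ)).subset fun n hn => ?_
  by_cases hm : ∃ m : ℕ, n = d * m
  · obtain ⟨m, rfl⟩ := hm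
    refine ⟨m, fun hlt => hn ?_, rfl⟩
    rwa [spread_apply hd]
  · refine absurd ?_ hn
    rw [spread_eq_zero u n fun m hm' => hm ⟨m, hm'⟩]
    simpa using hε

theorem tsum_spread_mul_spread {d : ℤ} (hd : d ≠ 0) (u v : ℕ → C) (n : ℤ) :
    ∑' m, spread d u m * spread d v (n - m) =
      spread d (fun N => ∑ q ∈ Finset.HasAntidiagonal.antidiagonal N, u q.1 * v q.2) n := by
  by_cases hn : ∃ N : ℕ, n = d * N
  · obtain ⟨N, rfl⟩ := hn
    rw [spread_apply hd, Finset.Nat.sum_antidiagonal_eq_sum_range_succ_mk]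
    have hsupp : Function.support (fun m => spread d u m * spread d v (d * N - m)) ⊆
        Set.range fun m : ℕ => d * (m : ℤ) := by
      intro m hm
      by_contra hc
      exact hm (by simp only [spread_eq_zero u m fun l hl => hc ⟨l, hl.symm⟩, zero_mul])
    rw [← (injective_spread hd).tsum_eq hsupp,
      tsum_eq_sum (s := Finset.range N.succ) fun m hm => ?_]
    · refine Finset.sum_congr rfl fun m hm => ?_
      have hm' : m ≤ N := by simpa [Nat.lt_succ_iff] using hm
      have e : d * (N : ℤ) - d * m = d * ((N - m : ℕ) : ℤ) := by push_cast [hm']; ring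
      rw [e, spread_apply hd, spread_apply hd]
    · rw [spread_eq_zero v, mul_zero]
      intro l hl
      rw [← mul_sub] at hl
      have := mul_left_cancel₀ hd hl
      have hm' : ¬ m < N.succ := by simpa using hm
      omega
  · rw [spread_eq_zero _ n fun m hm => hn ⟨m, hm⟩]
    refine (tsum_congr fun m => ?_).trans tsum_zero
    by_cases h1 : ∃ l : ℕ, m = d * l
    · obtain ⟨l, rfl⟩ := h1
      rw [spread_eq_zero v, mul_zero]
      intro l' hl'
      exact hn ⟨l + l', by push_cast; linarith⟩
    · rw [spread_eq_zero u m fun l hl => h1 ⟨l, hl⟩, zero_mul]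

end CircleSeries

open CircleSeries

variable {p : ℕ} [Fact p.Prime]

theorem spread_LSub_mem {b' : ℝ} (c : C) (hc : ‖c‖ ≤ 1) (hrp : r ^ 2 < (p : ℝ) ^ (b' * (1 - 1 / 3)))
    (f : L C p b') : spread 2 (fun m => c ^ m * PowerSeries.coeff m (L.val C p f)) ∈
      circleSubmodule C r := by
  have hr := hr.out
  have hp : (0 : ℝ) < p := by exact_mod_cast (Fact.out : p.Prime).pos
  obtain ⟨ρ, hf⟩ := f.2
  refine spread_mem two_ne_zero ?_
  refine squeeze_zero (g := fun m : ℕ => (p : ℝ) ^ (-ρ) *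
    (r ^ 2 / (p : ℝ) ^ (b' * (1 - 1 / 3))) ^ m) (fun m => by positivity) (fun m => ?_) ?_
  · have h1 : ‖c ^ m * PowerSeries.coeff m (L.val C p f)‖ ≤
        (p : ℝ) ^ (-(b' * (1 - 1 / 3) * m + ρ)) := by
      rw [norm_mul, norm_pow]
      exact (mul_le_of_le_one_left (norm_nonneg _)
        (pow_le_one₀ (norm_nonneg _) hc)).trans (hf m)
    refine (mul_le_mul_of_nonneg_right h1 (by positivity)).trans (le_of_eq ?_)
    rw [zpow_mul, zpow_natCast, div_pow, neg_add, Real.rpow_add hp, Real.rpow_neg hp.le,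
      Real.rpow_mul hp.le, Real.rpow_natCast]
    norm_cast
    ring
  · rw [← mul_zero ((p : ℝ) ^ (-ρ))]
    exact (tendsto_pow_atTop_nhds_zero_of_lt_one (by positivity)
      ((div_lt_one (by positivity)).2 hrp)).const_mul _

section

variable {b' : ℝ} (c : C) (hc : ‖c‖ ≤ 1) (hrp : r ^ 2 < (p : ℝ) ^ (b' * (1 - 1 / 3)))

/-- The Laurent series `f(c s²)`, for `f` in `L(b')`. -/
def circleSubst (f : L C p b') : CircleSeries C r := ⟨_, spread_LSub_mem c hc hrp f⟩

theorem coeff_circleSubst (f : L C p b') (m : ℕ) : (circleSubst c hc hrp f).coeff (2 * m) =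
    c ^ m * PowerSeries.coeff m (L.val C p f) :=
  spread_apply two_ne_zero (fun m => c ^ m * PowerSeries.coeff m (L.val C p f)) m

theorem coeff_circleSubst_eq_zero (f : L C p b') (n : ℤ) (h : ∀ m : ℕ, n ≠ 2 * m) :
    (circleSubst c hc hrp f).coeff n = 0 :=
  spread_eq_zero (fun m => c ^ m * PowerSeries.coeff m (L.val C p f)) n h

/-- The ring homomorphism `a ↦ c s²` from `L(b')` to the ring of Laurent series on `|s| = r`. -/
def circleOfL : L C p b' →+* CircleSeries C r where
  toFun := circleSubst c hc hrp
  map_zero' := by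
    ext n
    by_cases h : ∃ m : ℕ, n = 2 * m
    · obtain ⟨m, rfl⟩ := h; rw [coeff_circleSubst]; simp
    · exact coeff_circleSubst_eq_zero _ _ _ _ n fun m hm => h ⟨m, hm⟩
  map_one' := by
    ext n
    rw [one_def, coeff_mon]
    by_cases h : ∃ m : ℕ, n = 2 * m
    · obtain ⟨m, rfl⟩ := h
      rw [coeff_circleSubst, map_one, PowerSeries.coeff_one]
      by_cases h0 : m = 0
      · simp [h0]
      · simp [h0]
    · rw [coeff_circleSubst_eq_zero _ _ _ _ n fun m hm => h ⟨m, hm⟩, if_neg]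
      rintro rfl
      exact h ⟨0, rfl⟩
  map_add' f g := by
    ext n
    rw [coeff_add]
    by_cases h : ∃ m : ℕ, n = 2 * m
    · obtain ⟨m, rfl⟩ := h
      rw [coeff_circleSubst, coeff_circleSubst, coeff_circleSubst, map_add, map_add, mul_add]
    · have h' : ∀ m : ℕ, n ≠ 2 * m := fun m hm => h ⟨m, hm⟩
      rw [coeff_circleSubst_eq_zero _ _ _ _ n h', coeff_circleSubst_eq_zero _ _ _ _ n h',
        coeff_circleSubst_eq_zero _ _ _ _ n h', add_zero]
  map_mul' f g := by
    ext n
    refine Eq.trans ?_ (tsum_spread_mul_spread two_ne_zero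
      (fun m => c ^ m * PowerSeries.coeff m (L.val C p f))
      (fun m => c ^ m * PowerSeries.coeff m (L.val C p g)) n).symm
    change spread 2 (fun m => c ^ m * PowerSeries.coeff m (L.val C p (f * g))) n = _
    congr 1
    funext N
    rw [map_mul, PowerSeries.coeff_mul, Finset.mul_sum]
    refine Finset.sum_congr rfl fun q hq => ?_
    rw [← Finset.HasAntidiagonal.mem_antidiagonal.1 hq, pow_add]
    ring

theorem coeff_circleOfL (f : L C p b') (m : ℕ) : (circleOfL c hc hrp f).coeff (2 * m) =
    c ^ m * PowerSeries.coeff m (L.val C p f) := coeff_circleSubst c hc hrp f m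

theorem coeff_circleOfL_eq_zero (f : L C p b') (n : ℤ) (h : ∀ m : ℕ, n ≠ 2 * m) :
    (circleOfL c hc hrp f).coeff n = 0 := coeff_circleSubst_eq_zero c hc hrp f n h

theorem circleOfL_injective (hc0 : c ≠ 0) :
    Function.Injective (circleOfL (b' := b') c hc hrp) := by
  rw [injective_iff_map_eq_zero]
  intro f hf
  have inj : Function.Injective (L.val C p (b' := b')) := Subtype.val_injective
  apply inj
  ext m
  have := coeff_circleOfL c hc hrp f m
  rw [hf, CircleSeries.coeff_zero] at this
  simpa [hc0] using this.symm

theorem euler_circleOfL (f : L C p b') :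
    euler (circleOfL c hc hrp f) = 2 * circleOfL c hc hrp (eulerL C p b' f) := by
  ext n
  rw [two_mul, coeff_add, coeff_euler]
  by_cases h : ∃ m : ℕ, n = 2 * m
  · obtain ⟨m, rfl⟩ := h
    rw [coeff_circleOfL, coeff_circleOfL, val_eulerL, coeff_eulerA]
    push_cast
    ring
  · have h' : ∀ m : ℕ, n ≠ 2 * m := fun m hm => h ⟨m, hm⟩
    rw [coeff_circleOfL_eq_zero _ _ _ _ n h', coeff_circleOfL_eq_zero _ _ _ _ n h']
    simp

theorem circleOfL_const (d : C) :
    circleOfL c hc hrp (algebraMap C (L C p b') d) = mon r 0 d := by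
  ext n
  have e : L.val C p (algebraMap C (L C p b') d) = PowerSeries.C d := rfl
  rw [coeff_mon]
  by_cases h : ∃ m : ℕ, n = 2 * m
  · obtain ⟨m, rfl⟩ := h
    rw [coeff_circleOfL, e, PowerSeries.coeff_C]
    by_cases h0 : m = 0
    · simp [h0]
    · simp [h0]
  · rw [coeff_circleOfL_eq_zero _ _ _ _ n fun m hm => h ⟨m, hm⟩, if_neg]
    rintro rfl
    exact h ⟨0, rfl⟩

theorem circleOfL_a : circleOfL c hc hrp (L.a C p b') = mon r 2 c := by
  ext n
  have e : L.val C p (L.a C p b') = PowerSeries.X := rfl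
  rw [coeff_mon]
  by_cases h : ∃ m : ℕ, n = 2 * m
  · obtain ⟨m, rfl⟩ := h
    rw [coeff_circleOfL, e, PowerSeries.coeff_X]
    by_cases h0 : m = 1
    · simp [h0]
    · rw [if_neg h0, if_neg (by omega), mul_zero]
  · rw [coeff_circleOfL_eq_zero _ _ _ _ n fun m hm => h ⟨m, hm⟩, if_neg]
    rintro rfl
    exact h ⟨1, rfl⟩

end

end CircleSeries

/-! ### Norms of factorials and of products over arithmetic progressions -/

section Estimates

variable {p : ℕ} [Fact p.Prime]

theorem norm_intCast_padicInt (N : ℤ) : ‖(N : ℂ_[p])‖ = ‖(N : ℤ_[p])‖ := by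
  have h := PadicComplex.norm_extends' p (N : ℚ_[p])
  rw [PadicInt.norm_def, PadicInt.coe_intCast, ← h]
  congr 1
  have : algebraMap ℚ_[p] ℂ_[p] (N : ℚ_[p]) = (N : ℂ_[p]) := map_intCast _ N
  rw [← this, IsScalarTower.algebraMap_apply ℚ_[p] (PadicAlgCl p) ℂ_[p]]
  rfl

theorem norm_natCast_padicInt (N : ℕ) : ‖(N : ℂ_[p])‖ = ‖(N : ℤ_[p])‖ := by
  have := norm_intCast_padicInt (p := p) N
  simpa using this

theorem norm_intCast_le_pow_iff (N : ℤ) (n : ℕ) :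
    ‖(N : ℂ_[p])‖ ≤ ((p : ℝ)⁻¹) ^ n ↔ ((p ^ n : ℕ) : ℤ) ∣ N := by
  rw [norm_intCast_padicInt, PadicInt.norm_def, PadicInt.coe_intCast, Nat.cast_pow,
    ← Padic.norm_int_le_pow_iff_dvd, zpow_neg, zpow_natCast, inv_pow]

theorem norm_intCast_eq_one {N : ℤ} (h : ¬ (p : ℤ) ∣ N) : ‖(N : ℂ_[p])‖ = 1 := by
  refine le_antisymm (IsUltrametricDist.norm_intCast_le_one _ N) ?_
  by_contra hlt
  rw [not_le, norm_intCast_padicInt, PadicInt.norm_int_lt_one_iff_dvd] at hlt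
  exact h hlt

theorem norm_natCast_p : ‖(p : ℂ_[p])‖ = (p : ℝ)⁻¹ := by
  rw [norm_natCast_padicInt, PadicInt.norm_p]

theorem inv_natAbs_le_norm_intCast {N : ℤ} (hN : N ≠ 0) :
    ((N.natAbs : ℝ))⁻¹ ≤ ‖(N : ℂ_[p])‖ := by
  have hp : (0 : ℝ) < p := by exact_mod_cast (Fact.out : p.Prime).pos
  have hN' : (N : ℤ_[p]) ≠ 0 := Int.cast_ne_zero.2 hN
  have hNq : (N : ℚ_[p]) ≠ 0 := Int.cast_ne_zero.2 hN
  rw [norm_intCast_padicInt, PadicInt.norm_def, PadicInt.coe_intCast,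
    Padic.norm_eq_zpow_neg_valuation hNq, Padic.valuation_intCast, zpow_neg, zpow_natCast]
  refine inv_anti₀ (by positivity) ?_
  have : p ^ padicValInt p N ∣ N.natAbs := pow_padicValNat_dvd
  exact_mod_cast Nat.le_of_dvd (Int.natAbs_pos.2 hN) this

/-- A product of `m` terms of an arithmetic progression with difference prime to `p` is divisible
by `m!` in the `p`-adic integers. -/
theorem norm_prod_progression_le (A d : ℤ) (hd : ¬ (p : ℤ) ∣ d) (m : ℕ) :
    ‖∏ i ∈ Finset.range m, ((A + d * i : ℤ) : ℂ_[p])‖ ≤ ‖((m.factorial : ℕ) : ℂ_[p])‖ := by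
  have hd1 : ‖(d : ℤ_[p])‖ = 1 := by rw [← norm_intCast_padicInt, norm_intCast_eq_one hd]
  obtain ⟨u, hu⟩ := PadicInt.isUnit_iff.2 hd1
  have key : ∀ m : ℕ, ∏ i ∈ Finset.range m, ((A + d * i : ℤ) : ℤ_[p]) =
      (d : ℤ_[p]) ^ m * (ascPochhammer ℤ_[p] m).eval ((A : ℤ_[p]) * ↑u⁻¹) := by
    intro m
    induction m with
    | zero => simp
    | succ m ih =>
      have h1 : (d : ℤ_[p]) * ↑u⁻¹ = 1 := by rw [← hu]; exact u.mul_inv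
      rw [Finset.prod_range_succ, ih, ascPochhammer_succ_eval]
      push_cast
      linear_combination (-A * (d : ℤ_[p]) ^ m *
        (ascPochhammer ℤ_[p] m).eval ((A : ℤ_[p]) * ↑u⁻¹)) * h1
  rw [norm_natCast_padicInt]
  refine le_trans (le_of_eq ?_) (PadicInt.norm_ascPochhammer_le m ((A : ℤ_[p]) * (u⁻¹ : ℤ_[p]ˣ).val))
  have h2 := congrArg norm (key m)
  rw [norm_mul, norm_pow, hd1, one_pow, one_mul] at h2
  rw [← h2, norm_prod, norm_prod]
  exact Finset.prod_congr rfl fun i _ => norm_intCast_padicInt _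

/-- The residues of `p ^ e` consecutive terms of an arithmetic progression with difference prime to
`p` run once through the residues modulo `p ^ e`, so that only the term with residue zero can make
their product smaller than `(p ^ e)!`. -/
theorem le_norm_prod_progression (A d : ℤ) (hd : ¬ (p : ℤ) ∣ d) (e : ℕ)
    (h0 : ∀ i : ℕ, A + d * i ≠ 0) :
    (((A.natAbs + d.natAbs * p ^ e : ℕ)) : ℝ)⁻¹ * ‖(((p ^ e).factorial : ℕ) : ℂ_[p])‖ ≤
      ‖∏ i ∈ Finset.range (p ^ e), ((A + d * i : ℤ) : ℂ_[p])‖ := by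
  have hp := (Fact.out : p.Prime)
  have hq : 0 < p ^ e := pow_pos hp.pos e
  set q := p ^ e with hqdef
  -- `σ i` is the residue of the `i`-th term; below, `g s` is a lower bound for the norm
  -- of a term with residue `s`
  let σ : ℕ → ℕ := fun i => ((A + d * i) % (q : ℤ)).toNat
  have hσ : ∀ i, ((σ i : ℕ) : ℤ) = (A + d * i) % (q : ℤ) := fun i =>
    Int.toNat_of_nonneg (Int.emod_nonneg _ (by exact_mod_cast hq.ne'))
  have hσlt : ∀ i, σ i < q := fun i => by
    have := Int.emod_lt_of_pos (A + d * i) (b := (q : ℤ)) (by exact_mod_cast hq)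
    rw [← hσ] at this
    exact_mod_cast this
  have hcop : IsCoprime (q : ℤ) d := by
    rw [hqdef]; push_cast
    exact ((Nat.prime_iff_prime_int.1 hp).coprime_iff_not_dvd.2 hd).pow_left
  have hinj : Set.InjOn σ (Finset.range q) := by
    intro i hi j hj hij
    have h1 : (A + d * i) % (q : ℤ) = (A + d * j) % (q : ℤ) := by rw [← hσ, ← hσ, hij]
    have h2 : (q : ℤ) ∣ d * (j - i) := by
      have h3 := Int.ModEq.dvd (show A + d * i ≡ A + d * j [ZMOD q] from h1)
      rwa [show A + d * (j : ℤ) - (A + d * i) = d * (j - i) by ring] at h3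
    have h4 := hcop.dvd_of_dvd_mul_left h2
    have hi' : i < q := by simpa using hi
    have hj' : j < q := by simpa using hj
    have h5 := Int.eq_zero_of_abs_lt_dvd h4 (by rw [abs_lt]; constructor <;> omega)
    omega
  have himg : (Finset.range q).image σ = Finset.range q := by
    refine Finset.eq_of_subset_of_card_le (fun s hs => ?_) ?_
    · obtain ⟨i, _, rfl⟩ := Finset.mem_image.1 hs
      exact Finset.mem_range.2 (hσlt i)
    · rw [Finset.card_image_of_injOn hinj]
  let g : ℕ → ℝ := fun s => if s = 0 then (((A.natAbs + d.natAbs * q : ℕ)) : ℝ)⁻¹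
    else ‖(s : ℂ_[p])‖
  have hg0 : ∀ s, 0 ≤ g s := fun s => by
    simp only [g]; split_ifs <;> positivity
  have hle : ∀ i ∈ Finset.range q, g (σ i) ≤ ‖((A + d * i : ℤ) : ℂ_[p])‖ := by
    intro i hi
    have hi' : i < q := by simpa using hi
    simp only [g]
    split_ifs with hs
    · refine le_trans ?_ (inv_natAbs_le_norm_intCast (h0 i))
      have h1 : 0 < (A + d * i).natAbs := Int.natAbs_pos.2 (h0 i)
      refine inv_anti₀ (by exact_mod_cast h1) ?_
      have h2 : (A + d * i).natAbs ≤ A.natAbs + d.natAbs * q := by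
        refine (Int.natAbs_add_le _ _).trans ?_
        rw [Int.natAbs_mul, Int.natAbs_natCast]
        gcongr
      exact_mod_cast h2
    · by_contra hlt
      rw [not_le] at hlt
      have e1 : ((σ i : ℕ) : ℂ_[p]) = ((A + d * i : ℤ) : ℂ_[p]) -
          ((q * ((A + d * i) / (q : ℤ)) : ℤ) : ℂ_[p]) := by
        rw [← Int.cast_sub, ← Int.cast_natCast (σ i), hσ]
        congr 1
        have := Int.emod_add_mul_ediv (A + d * i) q
        linarith
      have h2 : ‖((q * ((A + d * i) / (q : ℤ)) : ℤ) : ℂ_[p])‖ ≤ ((p : ℝ)⁻¹) ^ e := by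
        rw [norm_intCast_le_pow_iff]
        exact Dvd.intro _ rfl
      have h3 : ‖((σ i : ℕ) : ℂ_[p])‖ ≤ ((p : ℝ)⁻¹) ^ e := by
        have h4 := IsUltrametricDist.norm_add_le_max ((A + d * i : ℤ) : ℂ_[p])
          (-((q * ((A + d * i) / (q : ℤ)) : ℤ) : ℂ_[p]))
        rw [← sub_eq_add_neg, ← e1, norm_neg] at h4
        rcases le_max_iff.1 h4 with h5 | h5
        · exact absurd hlt (not_lt.2 h5)
        · exact h5.trans h2
      have h5 : ‖(((σ i : ℕ) : ℤ) : ℂ_[p])‖ ≤ ((p : ℝ)⁻¹) ^ e := by simpa using h3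
      rw [norm_intCast_le_pow_iff] at h5
      have h6 : q ∣ σ i := by exact_mod_cast h5
      exact absurd (Nat.le_of_dvd (Nat.pos_of_ne_zero hs) h6) (not_le.2 (hσlt i))
  have hfac : ∀ n : ℕ, ∏ s ∈ Finset.range n, ‖((s + 1 : ℕ) : ℂ_[p])‖ =
      ‖((n.factorial : ℕ) : ℂ_[p])‖ := fun n => by
    rw [← Finset.prod_range_add_one_eq_factorial, Nat.cast_prod, norm_prod]
  rw [norm_prod]
  refine le_trans ?_ (Finset.prod_le_prod (fun i _ => hg0 _) hle)
  rw [← Finset.prod_image (f := g) hinj, himg]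
  obtain ⟨q', hq'⟩ := Nat.exists_eq_succ_of_ne_zero hq.ne'
  rw [hq', Finset.prod_range_succ', mul_comm]
  have e2 : ∏ k ∈ Finset.range q', g (k + 1) = ‖((q'.factorial : ℕ) : ℂ_[p])‖ := by
    rw [← hfac]
    exact Finset.prod_congr rfl fun k _ => by simp [g]
  have e3 : g 0 = (((A.natAbs + d.natAbs * q'.succ : ℕ)) : ℝ)⁻¹ := by simp [g, hq']
  rw [e2, e3]
  refine mul_le_mul_of_nonneg_right ?_ (by positivity)
  rw [Nat.factorial_succ, Nat.cast_mul, norm_mul]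
  exact mul_le_of_le_one_left (norm_nonneg _) (IsUltrametricDist.norm_natCast_le_one _ _)

variable {π : ℂ_[p]}

theorem norm_pi_pow (hπ : π ^ (p - 1) = -(p : ℂ_[p])) : ‖π‖ ^ (p - 1) = (p : ℝ)⁻¹ := by
  rw [← norm_pow, hπ, norm_neg, norm_natCast_p]

theorem norm_pi_pos (hπ : π ^ (p - 1) = -(p : ℂ_[p])) : 0 < ‖π‖ := by
  have hp := (Fact.out : p.Prime)
  rw [norm_pos_iff]
  rintro rfl
  have h1 := hp.one_lt
  rw [zero_pow (by omega), eq_comm, neg_eq_zero, Nat.cast_eq_zero] at hπ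
  exact hp.ne_zero hπ

theorem norm_pi_lt_one (hπ : π ^ (p - 1) = -(p : ℂ_[p])) : ‖π‖ < 1 := by
  have hp := (Fact.out : p.Prime)
  have h1 := hp.one_lt
  by_contra h
  rw [not_lt] at h
  have h2 := one_le_pow₀ (n := p - 1) h
  rw [norm_pi_pow hπ] at h2
  have : (1 : ℝ) < p := by exact_mod_cast h1
  have := inv_lt_one_of_one_lt₀ this
  linarith

/-- Legendre's formula. -/
theorem norm_factorial (hπ : π ^ (p - 1) = -(p : ℂ_[p])) (m : ℕ) :
    ‖((m.factorial : ℕ) : ℂ_[p])‖ = ‖π‖ ^ (m - (p.digits m).sum) := by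
  have hq : ((m.factorial : ℕ) : ℚ_[p]) ≠ 0 := Nat.cast_ne_zero.2 m.factorial_ne_zero
  rw [norm_natCast_padicInt, PadicInt.norm_def, PadicInt.coe_natCast,
    Padic.norm_eq_zpow_neg_valuation hq, Padic.valuation_natCast,
    ← sub_one_mul_padicValNat_factorial, pow_mul, norm_pi_pow hπ, zpow_neg, zpow_natCast, inv_pow]

theorem norm_factorial_prime_pow (hπ : π ^ (p - 1) = -(p : ℂ_[p])) (e : ℕ) :
    ‖(((p ^ e).factorial : ℕ) : ℂ_[p])‖ = ‖π‖ ^ (p ^ e - 1) := by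
  have hp := (Fact.out : p.Prime)
  have : (p.digits (p ^ e)).sum = 1 := by
    have h := Nat.digits_base_pow_mul (b := p) (k := e) (m := 1) hp.one_lt one_pos
    rw [mul_one] at h
    rw [h, Nat.digits_of_lt p 1 one_ne_zero hp.one_lt]
    simp
  rw [norm_factorial hπ, this]

theorem norm_factorial_le (hπ : π ^ (p - 1) = -(p : ℂ_[p])) (m : ℕ) :
    ‖((m.factorial : ℕ) : ℂ_[p])‖ ≤ p * (m + 1) * ‖π‖ ^ m := by
  have hp := (Fact.out : p.Prime)
  have h1 : (1 : ℝ) < p := by exact_mod_cast hp.one_lt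
  have hpos := norm_pi_pos hπ
  rcases Nat.eq_zero_or_pos m with rfl | hm
  · simpa using h1.le
  set s := (p.digits m).sum
  set l := (p.digits m).length
  have hs : s ≤ m := Nat.digit_sum_le p m
  have hsl : s ≤ (p - 1) * l := by
    have := List.sum_le_card_nsmul (p.digits m) (p - 1) fun d hd =>
      Nat.le_sub_one_of_lt (Nat.digits_lt_base hp.one_lt hd)
    rwa [smul_eq_mul, mul_comm] at this
  have hl : (p : ℝ) ^ l ≤ p * m := by
    exact_mod_cast Nat.base_pow_length_digits_le p m hp.one_lt hm.ne'
  rw [norm_factorial hπ]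
  have h2 : ‖π‖ ^ ((p - 1) * l) ≤ ‖π‖ ^ s :=
    pow_le_pow_of_le_one hpos.le (norm_pi_lt_one hπ).le hsl
  rw [pow_mul, norm_pi_pow hπ] at h2
  have h3 : 1 ≤ p * (m + 1) * ‖π‖ ^ s := by
    have h4 : (1 : ℝ) = p ^ l * ((p : ℝ)⁻¹) ^ l := by
      rw [← mul_pow, mul_inv_cancel₀ (by positivity), one_pow]
    rw [h4]
    refine mul_le_mul (hl.trans ?_) h2 (by positivity) (by positivity)
    nlinarith
  calc ‖π‖ ^ (m - s) ≤ ‖π‖ ^ (m - s) * (p * (m + 1) * ‖π‖ ^ s) :=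
        le_mul_of_one_le_right (by positivity) h3
    _ = p * (m + 1) * ‖π‖ ^ m := by
        rw [← Nat.sub_add_cancel hs, pow_add]
        simp only [Nat.sub_add_cancel hs]
        ring

end Estimates

section Equation

variable {p : ℕ} [Fact p.Prime] {π : ℂ_[p]} {r : ℝ} [hr : Fact (0 < r)]

theorem CircleSeries.false_of_le (f : CircleSeries ℂ_[p] r) (g : ℕ → ℤ)
    (hg : Function.Injective g) (c : ℝ) (hc : 0 < c) (h : ∀ e, c ≤ ‖f.coeff (g e)‖ * r ^ g e) :
    False := by
  have h1 := (f.tendsto.comp hg.tendsto_cofinite).eventually (gt_mem_nhds hc)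
  rw [Nat.cofinite_eq_atTop] at h1
  obtain ⟨e, he⟩ := h1.exists
  exact absurd he (not_lt.2 (h e))

variable {k β : ℤ} {f : CircleSeries ℂ_[p] r}

/-- The recursion of `f`, followed upwards over `m` steps. -/
theorem mul_prod_up (hf : ∀ n : ℤ, ((2 * n - k : ℤ) : ℂ_[p]) * f.coeff n =
      -12 * π * β * f.coeff (n - 3)) (n : ℤ) (m : ℕ) :
    f.coeff (n + 3 * m) * ∏ i ∈ Finset.range m, (((2 * n + 6 - k) + 6 * i : ℤ) : ℂ_[p]) =
      (-12 * π * β) ^ m * f.coeff n := by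
  induction m with
  | zero => simp
  | succ m ih =>
    have h := hf (n + 3 * (m + 1))
    rw [show n + 3 * ((m : ℤ) + 1) - 3 = n + 3 * m by ring] at h
    rw [Finset.prod_range_succ, pow_succ]
    push_cast at h ih ⊢
    linear_combination (∏ i ∈ Finset.range m, ((2 * n + 6 - k) + 6 * i : ℂ_[p])) * h +
      (-12 * π * β) * ih

/-- The recursion of `f`, followed downwards over `m` steps. -/
theorem mul_prod_down (hf : ∀ n : ℤ, ((2 * n - k : ℤ) : ℂ_[p]) * f.coeff n =
      -12 * π * β * f.coeff (n - 3)) (n : ℤ) (m : ℕ) :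
    f.coeff n * ∏ i ∈ Finset.range m, (((2 * n - k) + (-6) * i : ℤ) : ℂ_[p]) =
      (-12 * π * β) ^ m * f.coeff (n - 3 * m) := by
  induction m with
  | zero => simp
  | succ m ih =>
    have h := hf (n - 3 * m)
    rw [show n - 3 * (m : ℤ) - 3 = n - 3 * ((m : ℤ) + 1) by ring] at h
    rw [Finset.prod_range_succ, pow_succ]
    push_cast at h ih ⊢
    linear_combination ((2 * n - k) + (-6) * m : ℂ_[p]) * ih + (-12 * π * β) ^ m * h

/-- A nonzero coefficient `fₙ` would keep `f_{n+3pᵉ}` above `‖π‖ ‖fₙ‖` for all `e`, by Legendre's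
formula, although the series converges for `|s| = r > 1`. -/
theorem eq_zero_of_not_dvd (hπ : π ^ (p - 1) = -(p : ℂ_[p])) (hr1 : 1 < r)
    (hf : ∀ n : ℤ, ((2 * n - k : ℤ) : ℂ_[p]) * f.coeff n = -12 * π * β * f.coeff (n - 3))
    (hβ : ¬ (p : ℤ) ∣ 12 * β) (h6 : ¬ (p : ℤ) ∣ 6) : f = 0 := by
  have hpr := (Fact.out : p.Prime)
  have hpos := norm_pi_pos hπ
  ext n
  rw [CircleSeries.coeff_zero]
  by_contra hn
  have hn' : 0 < ‖f.coeff n‖ := norm_pos_iff.2 hn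
  refine f.false_of_le (fun e => n + 3 * ((p ^ e : ℕ) : ℤ)) (fun a b hab => ?_)
    (‖π‖ * ‖f.coeff n‖ * r ^ n) (by positivity) fun e => ?_
  · have : (p ^ a : ℕ) = p ^ b := by
      have h1 : n + 3 * ((p ^ a : ℕ) : ℤ) = n + 3 * ((p ^ b : ℕ) : ℤ) := hab
      omega
    exact Nat.pow_right_injective hpr.two_le this
  · have h1 := congrArg norm (mul_prod_up hf n (p ^ e))
    have h2 := norm_prod_progression_le (2 * n + 6 - k) 6 h6 (p ^ e)
    rw [norm_factorial_prime_pow hπ] at h2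
    have h3 : ‖(-12 * π * β : ℂ_[p])‖ = ‖π‖ := by
      have : (-12 * π * β : ℂ_[p]) = -(π * ((12 * β : ℤ) : ℂ_[p])) := by push_cast; ring
      rw [this, norm_neg, norm_mul, norm_intCast_eq_one hβ, mul_one]
    rw [norm_mul, norm_mul, norm_pow, h3] at h1
    have hq : 0 < p ^ e := pow_pos hpr.pos e
    have h4 : ‖π‖ * ‖f.coeff n‖ ≤ ‖f.coeff (n + 3 * ((p ^ e : ℕ) : ℤ))‖ := by
      have h5 : ‖π‖ ^ (p ^ e) * ‖f.coeff n‖ ≤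
          ‖f.coeff (n + 3 * ((p ^ e : ℕ) : ℤ))‖ * ‖π‖ ^ (p ^ e - 1) :=
        h1 ▸ mul_le_mul_of_nonneg_left h2 (norm_nonneg _)
      have h6 : ‖π‖ ^ (p ^ e) = ‖π‖ * ‖π‖ ^ (p ^ e - 1) := by
        rw [← pow_succ', Nat.sub_add_cancel hq]
      rw [h6, mul_right_comm] at h5
      exact le_of_mul_le_mul_right h5 (by positivity)
    refine mul_le_mul h4 ?_ (by have := hr.out; positivity) (norm_nonneg _)
    exact zpow_le_zpow_right₀ hr1.le (by omega)

/-- A nonzero coefficient `fₙ` would make `f_{n-3m}`, for `m = pᵉ`, at least of the order of `pᵐ / m`,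
because each step down divides by `β`. This contradicts convergence when `r³ < p`. -/
theorem eq_zero_of_dvd (hπ : π ^ (p - 1) = -(p : ℂ_[p])) (hrp : r ^ 3 < p)
    (hf : ∀ n : ℤ, ((2 * n - k : ℤ) : ℂ_[p]) * f.coeff n = -12 * π * β * f.coeff (n - 3))
    (hβ : (p : ℤ) ∣ β) (hk : Odd k) (h6 : ¬ (p : ℤ) ∣ 6) : f = 0 := by
  have hpr := (Fact.out : p.Prime)
  have hp0 : (0 : ℝ) < p := by exact_mod_cast hpr.pos
  have hr0 := hr.out
  have hpos := norm_pi_pos hπ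
  ext n
  rw [CircleSeries.coeff_zero]
  by_contra hn
  have hn' : 0 < ‖f.coeff n‖ := norm_pos_iff.2 hn
  set a := (2 * n - k).natAbs with ha
  -- `c (a + 6 m) ≤ 1 + m δ ≤ (p / r³)ᵐ`, by Bernoulli's inequality
  set δ := p / r ^ 3 - 1 with hδ
  have hδ0 : 0 < δ := by rw [hδ, sub_pos, one_lt_div (by positivity)]; exact hrp
  set c := min (1 / ((a : ℝ) + 1)) (δ / 6) with hc
  have hc0 : 0 < c := by rw [hc]; positivity
  have hca : c * a ≤ 1 := by
    have h1 : c ≤ 1 / ((a : ℝ) + 1) := min_le_left _ _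
    rw [le_div_iff₀ (by positivity)] at h1
    nlinarith
  have hcδ : c * 6 ≤ δ := by
    have h1 : c ≤ δ / 6 := min_le_right _ _
    linarith
  refine f.false_of_le (fun e => n - 3 * ((p ^ e : ℕ) : ℤ)) (fun a b hab => ?_)
    (‖f.coeff n‖ * c * r ^ n) (by positivity) fun e => ?_
  · have : (p ^ a : ℕ) = p ^ b := by
      have h1 : n - 3 * ((p ^ a : ℕ) : ℤ) = n - 3 * ((p ^ b : ℕ) : ℤ) := hab
      omega
    exact Nat.pow_right_injective hpr.two_le this
  · have hq : 0 < p ^ e := pow_pos hpr.pos e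
    have h0 : ∀ i : ℕ, (2 * n - k) + (-6) * (i : ℤ) ≠ 0 := fun i h => by
      obtain ⟨l, hl⟩ := hk
      omega
    have h1 := congrArg norm (mul_prod_down hf n (p ^ e))
    have h2 := le_norm_prod_progression (p := p) (2 * n - k) (-6)
      (fun h => h6 ((dvd_neg).1 h)) e h0
    rw [norm_factorial_prime_pow hπ] at h2
    set m := p ^ e with hm
    have h3 : ‖(-12 * π * β : ℂ_[p])‖ ≤ ‖π‖ * (p : ℝ)⁻¹ := by
      have e1 : (-12 * π * β : ℂ_[p]) = ((-12 : ℤ) : ℂ_[p]) * (π * β) := by push_cast; ring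
      rw [e1, norm_mul, norm_mul]
      have e2 : ‖(β : ℂ_[p])‖ ≤ (p : ℝ)⁻¹ := by
        have := (norm_intCast_le_pow_iff (p := p) β 1).2 (by rwa [pow_one])
        rwa [pow_one] at this
      exact (mul_le_of_le_one_left (by positivity)
        (IsUltrametricDist.norm_intCast_le_one _ _)).trans
        (mul_le_mul_of_nonneg_left e2 (norm_nonneg _))
    rw [norm_mul, norm_mul, norm_pow] at h1
    have h4 : ‖f.coeff n‖ * ((((a + 6 * m : ℕ)) : ℝ)⁻¹ * ‖π‖ ^ (m - 1)) ≤
        (‖π‖ * (p : ℝ)⁻¹) ^ m * ‖f.coeff (n - 3 * (m : ℤ))‖ := by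
      refine le_trans (mul_le_mul_of_nonneg_left h2 (norm_nonneg _)) ?_
      rw [h1]
      gcongr
    have hpi : ‖π‖ ^ m ≤ ‖π‖ ^ (m - 1) :=
      pow_le_pow_of_le_one hpos.le (norm_pi_lt_one hπ).le (Nat.sub_le _ _)
    have h5 : ‖f.coeff n‖ * (((a + 6 * m : ℕ)) : ℝ)⁻¹ * p ^ m ≤
        ‖f.coeff (n - 3 * (m : ℤ))‖ := by
      have h6 : ‖f.coeff n‖ * (((a + 6 * m : ℕ)) : ℝ)⁻¹ * ‖π‖ ^ m ≤
          (‖π‖ * (p : ℝ)⁻¹) ^ m * ‖f.coeff (n - 3 * (m : ℤ))‖ := by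
        refine le_trans ?_ h4
        rw [mul_assoc]
        gcongr
      rw [mul_pow, inv_pow, mul_assoc (‖π‖ ^ m), mul_comm _ (‖π‖ ^ m)] at h6
      have h7 := le_of_mul_le_mul_left h6 (by positivity)
      rw [inv_mul_eq_div, le_div_iff₀ (by positivity)] at h7
      exact h7
    have h8 : c * (((a + 6 * m : ℕ)) : ℝ) ≤ (p / r ^ 3) ^ m := by
      have h9 := one_add_mul_le_pow (a := δ) (by linarith) m
      rw [hδ, add_sub_cancel] at h9
      refine le_trans ?_ h9
      rw [← hδ]
      push_cast
      nlinarith [(Nat.cast_nonneg m : (0 : ℝ) ≤ m)]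
    have hN : (0 : ℝ) < ((a + 6 * m : ℕ) : ℝ) := by
      have : 0 < a + 6 * m := by omega
      exact_mod_cast this
    have h10 : c ≤ (((a + 6 * m : ℕ)) : ℝ)⁻¹ * (p / r ^ 3) ^ m := by
      rw [inv_mul_eq_div, le_div_iff₀ hN]; exact h8
    have h11 : r ^ (n - 3 * (m : ℤ)) = r ^ n * ((r ^ 3) ^ m)⁻¹ := by
      rw [zpow_sub₀ hr0.ne', div_eq_mul_inv, zpow_mul, zpow_natCast]
      norm_cast
    change ‖f.coeff n‖ * c * r ^ n ≤ ‖f.coeff (n - 3 * (m : ℤ))‖ * r ^ (n - 3 * (m : ℤ))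
    rw [h11]
    calc ‖f.coeff n‖ * c * r ^ n
        ≤ ‖f.coeff n‖ * ((((a + 6 * m : ℕ)) : ℝ)⁻¹ * (p / r ^ 3) ^ m) * r ^ n := by gcongr
      _ = (‖f.coeff n‖ * (((a + 6 * m : ℕ)) : ℝ)⁻¹ * p ^ m) * (r ^ n * ((r ^ 3) ^ m)⁻¹) := by
          rw [div_pow]; ring
      _ ≤ _ := by gcongr

end Equation

/-! ### The solutions of the Airy system at infinity -/

section

variable {p : ℕ} [Fact p.Prime] (π : ℂ_[p])

/-- The coefficient of `s⁻³ᵐ` in `B = (P - R) / 2`, where `s^(-1/2) exp(2 π s³)` times `P` and times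
`-s R` are the formal solution of the Airy equation at infinity and its derivative. The equations are
`s dA/ds = B / 2` and `s dB/ds = A / 2 - 12 π s³ B`, for `A = (P + R) / 2`. -/
def wkbB : ℕ → ℂ_[p]
  | 0 => 0
  | 1 => (12 * π)⁻¹
  | m + 2 => wkbB (m + 1) * ((5 + 6 * m) * (7 + 6 * m)) / (144 * (m + 1) * π)

/-- The coefficient of `s⁻³ᵐ` in `A = (P + R) / 2`. -/
def wkbA (m : ℕ) : ℂ_[p] := 24 * π * wkbB π (m + 1) - 6 * m * wkbB π m

variable {π}

theorem wkbA_zero (h0 : π ≠ 0) : wkbA π 0 = 2 := by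
  simp only [wkbA, wkbB]
  field_simp
  norm_num

theorem wkbB_eq (h0 : π ≠ 0) (m : ℕ) : -6 * m * wkbA π m = wkbB π m := by
  cases m with
  | zero => simp [wkbB]
  | succ m =>
    have hm : (m + 1 : ℂ_[p]) ≠ 0 := by exact_mod_cast m.succ_ne_zero
    simp only [wkbA, wkbB]
    push_cast
    field_simp
    ring

theorem norm_wkbB_le (hπ : π ^ (p - 1) = -(p : ℂ_[p])) (h6 : ¬ (p : ℤ) ∣ 6)
    (h12 : ¬ (p : ℤ) ∣ 12) (h144 : ¬ (p : ℤ) ∣ 144) (m : ℕ) :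
    ‖wkbB π m‖ ≤ p / ‖π‖ * (m + 1) := by
  have hpos := norm_pi_pos hπ
  have h0 : π ≠ 0 := norm_pos_iff.1 hpos
  cases m with
  | zero => simp only [wkbB, norm_zero]; positivity
  | succ m =>
    have key : ∀ m : ℕ, wkbB π (m + 1) * (12 * π * (144 * π) ^ m * (m.factorial : ℕ)) =
        (∏ i ∈ Finset.range m, ((5 + 6 * i : ℤ) : ℂ_[p])) *
          ∏ i ∈ Finset.range m, ((7 + 6 * i : ℤ) : ℂ_[p]) := by
      intro m
      induction m with
      | zero =>
        simp only [wkbB, Finset.range_zero, Finset.prod_empty, pow_zero, Nat.factorial_zero,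
          Nat.cast_one, mul_one]
        exact inv_mul_cancel₀ (mul_ne_zero (by norm_num) h0)
      | succ m ih =>
        have hm : (m + 1 : ℂ_[p]) ≠ 0 := by exact_mod_cast m.succ_ne_zero
        rw [Finset.prod_range_succ, Finset.prod_range_succ, wkbB, Nat.factorial_succ, pow_succ]
        push_cast at ih ⊢
        field_simp at ih ⊢
        linear_combination ((5 + 6 * m) * (7 + 6 * m) : ℂ_[p]) * ih
    have h1 := congrArg norm (key m)
    have e12 : ‖(12 : ℂ_[p])‖ = 1 := by simpa using norm_intCast_eq_one (p := p) h12
    have e144 : ‖(144 : ℂ_[p])‖ = 1 := by simpa using norm_intCast_eq_one (p := p) h144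
    rw [norm_mul, norm_mul, norm_mul, norm_mul, norm_mul, norm_pow, norm_mul, e12, e144, one_mul] at h1
    have h2 := norm_prod_progression_le (p := p) 5 6 h6 m
    have h3 := norm_prod_progression_le (p := p) 7 6 h6 m
    have h4 := norm_factorial_le hπ m
    set F := ‖((m.factorial : ℕ) : ℂ_[p])‖
    have hF : 0 < F := norm_pos_iff.2 (Nat.cast_ne_zero.2 m.factorial_ne_zero)
    have h5 : ‖wkbB π (m + 1)‖ * (‖π‖ * ‖π‖ ^ m * F) ≤ F * F := by
      rw [h1]
      exact mul_le_mul h2 h3 (norm_nonneg _) hF.le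
    have h6 : ‖wkbB π (m + 1)‖ * (‖π‖ * ‖π‖ ^ m) ≤ F := by
      rw [← mul_assoc] at h5
      exact le_of_mul_le_mul_right h5 hF
    have h7 : ‖wkbB π (m + 1)‖ * ‖π‖ ≤ p * (m + 1) := by
      have := h6.trans h4
      rw [← mul_assoc] at this
      exact le_of_mul_le_mul_right this (by positivity)
    have hp0 : (0 : ℝ) ≤ p := Nat.cast_nonneg _
    rw [div_mul_eq_mul_div, le_div_iff₀ hpos]
    push_cast
    nlinarith

theorem norm_wkbA_le (hπ : π ^ (p - 1) = -(p : ℂ_[p])) (h6 : ¬ (p : ℤ) ∣ 6)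
    (h12 : ¬ (p : ℤ) ∣ 12) (h144 : ¬ (p : ℤ) ∣ 144) (m : ℕ) :
    ‖wkbA π m‖ ≤ p / ‖π‖ * (m + 2) := by
  have hpos := norm_pi_pos hπ
  have h1 := norm_wkbB_le hπ h6 h12 h144 m
  have h2 := norm_wkbB_le hπ h6 h12 h144 (m + 1)
  have hD : 0 ≤ (p : ℝ) / ‖π‖ := by positivity
  rw [wkbA, sub_eq_add_neg]
  refine (IsUltrametricDist.norm_add_le_max _ _).trans (max_le ?_ ?_)
  · rw [norm_mul, norm_mul]
    have e24 : ‖(24 : ℂ_[p])‖ ≤ 1 := by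
      simpa using IsUltrametricDist.norm_natCast_le_one ℂ_[p] 24
    push_cast at h2
    calc ‖(24 : ℂ_[p])‖ * ‖π‖ * ‖wkbB π (m + 1)‖ ≤ 1 * 1 * ‖wkbB π (m + 1)‖ := by
          gcongr; exact (norm_pi_lt_one hπ).le
      _ ≤ _ := by linarith
  · rw [norm_neg, norm_mul]
    have e6 : ‖(6 * m : ℂ_[p])‖ ≤ 1 := by
      have := IsUltrametricDist.norm_natCast_le_one ℂ_[p] (6 * m)
      push_cast at this
      exact this
    calc ‖(6 * m : ℂ_[p])‖ * ‖wkbB π m‖ ≤ 1 * ‖wkbB π m‖ := by gcongr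
      _ ≤ _ := by linarith

end

section

variable {p : ℕ} [Fact p.Prime] {π : ℂ_[p]} {r : ℝ} [hr : Fact (0 < r)]

open CircleSeries

theorem spread_wkb_mem (hp : 5 ≤ p) (hπ : π ^ (p - 1) = -(p : ℂ_[p])) (hr1 : 1 < r)
    (ε δ : ℤˣ) :
    spread (-3) (fun m => ((ε : ℤ) : ℂ_[p]) ^ m * (wkbA π m + ((δ : ℤ) : ℂ_[p]) * wkbB π m)) ∈
      circleSubmodule ℂ_[p] r := by
  have hpr := (Fact.out : p.Prime)
  have hr0 := hr.out
  have hpos := norm_pi_pos hπ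
  have hndvd : ∀ a b : ℕ, ¬ (p : ℤ) ∣ ((2 ^ a * 3 ^ b : ℕ) : ℤ) := fun a b h => by
    rw [Int.natCast_dvd_natCast, hpr.dvd_mul] at h
    rcases h with h | h
    · have := Nat.le_of_dvd (by norm_num) (hpr.dvd_of_dvd_pow h); omega
    · have := Nat.le_of_dvd (by norm_num) (hpr.dvd_of_dvd_pow h); omega
  have hA := norm_wkbA_le hπ (hndvd 1 1) (hndvd 2 1) (hndvd 4 2)
  have hB := norm_wkbB_le hπ (hndvd 1 1) (hndvd 2 1) (hndvd 4 2)
  have hD : 0 ≤ (p : ℝ) / ‖π‖ := by positivity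
  refine spread_mem (by norm_num) ?_
  set x := (r ^ 3)⁻¹ with hx
  have hx0 : 0 ≤ x := by positivity
  have hx1 : x < 1 := inv_lt_one_of_one_lt₀ (one_lt_pow₀ hr1 (by norm_num))
  refine squeeze_zero (g := fun m : ℕ => (p : ℝ) / ‖π‖ * ((m : ℝ) * x ^ m + 2 * x ^ m))
    (fun m => by positivity) (fun m => ?_) ?_
  · have e1 : r ^ (-3 * (m : ℤ)) = x ^ m := by
      rw [zpow_mul, zpow_natCast, hx]; norm_cast
    have e2 : ‖((ε : ℤ) : ℂ_[p]) ^ m * (wkbA π m + ((δ : ℤ) : ℂ_[p]) * wkbB π m)‖ ≤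
        p / ‖π‖ * (m + 2) := by
      rw [norm_mul, norm_pow]
      refine (mul_le_of_le_one_left (norm_nonneg _) (pow_le_one₀ (norm_nonneg _)
        (IsUltrametricDist.norm_intCast_le_one _ _))).trans ?_
      refine (IsUltrametricDist.norm_add_le_max _ _).trans (max_le (hA m) ?_)
      rw [norm_mul]
      refine (mul_le_of_le_one_left (norm_nonneg _)
        (IsUltrametricDist.norm_intCast_le_one _ _)).trans ((hB m).trans ?_)
      gcongr
      norm_num
    rw [e1]
    calc _ ≤ p / ‖π‖ * (m + 2) * x ^ m := by gcongr
      _ = _ := by ring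
  · have h1 := tendsto_self_mul_const_pow_of_lt_one hx0 hx1
    have h2 := tendsto_pow_atTop_nhds_zero_of_lt_one hx0 hx1
    simpa using (h1.add (h2.const_mul 2)).const_mul ((p : ℝ) / ‖π‖)

/-- The Laurent series `∑ₘ εᵐ (Aₘ + δ Bₘ) s⁻³ᵐ`, for signs `ε` and `δ`. For `δ = 1` it is the factor
`P_ε` of the solution `s^(-1/2) exp(2 ε π s³) P_ε` of the Airy equation, and `-ε s` times the series
for `δ = -1` is the factor of `π⁻¹` times its derivative in `a`. -/
def wkb (hp : 5 ≤ p) (hπ : π ^ (p - 1) = -(p : ℂ_[p])) (hr1 : 1 < r) (ε δ : ℤˣ) :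
    CircleSeries ℂ_[p] r := ⟨_, spread_wkb_mem hp hπ hr1 ε δ⟩

variable (hp : 5 ≤ p) (hπ : π ^ (p - 1) = -(p : ℂ_[p])) (hr1 : 1 < r)

theorem coeff_wkb (ε δ : ℤˣ) (m : ℕ) : (wkb hp hπ hr1 ε δ).coeff (-3 * m) =
    ((ε : ℤ) : ℂ_[p]) ^ m * (wkbA π m + ((δ : ℤ) : ℂ_[p]) * wkbB π m) :=
  spread_apply (by norm_num)
    (fun m => ((ε : ℤ) : ℂ_[p]) ^ m * (wkbA π m + ((δ : ℤ) : ℂ_[p]) * wkbB π m)) m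

theorem coeff_wkb_eq_zero (ε δ : ℤˣ) (n : ℤ) (h : ∀ m : ℕ, n ≠ -3 * m) :
    (wkb hp hπ hr1 ε δ).coeff n = 0 :=
  spread_eq_zero
    (fun m => ((ε : ℤ) : ℂ_[p]) ^ m * (wkbA π m + ((δ : ℤ) : ℂ_[p]) * wkbB π m)) n h

theorem coeff_wkb_zero (ε δ : ℤˣ) : (wkb hp hπ hr1 ε δ).coeff 0 = 2 := by
  have h0 : π ≠ 0 := norm_pos_iff.1 (norm_pi_pos hπ)
  have := coeff_wkb hp hπ hr1 ε δ 0
  simpa [wkbA_zero h0, wkbB] using this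

theorem coeff_wkb_pos (ε δ : ℤˣ) (n : ℤ) (hn : 0 < n) : (wkb hp hπ hr1 ε δ).coeff n = 0 :=
  coeff_wkb_eq_zero hp hπ hr1 ε δ n fun m hm => by omega

/-- The differential equations that link the two factors `δ = 1` and `δ = -1`. -/
theorem euler_wkb (ε δ : ℤˣ) : euler (wkb hp hπ hr1 ε δ) =
    mon r 0 (((δ : ℤ) : ℂ_[p]) / 2) * wkb hp hπ hr1 ε δ +
      mon r 3 (6 * π * (ε : ℤ)) * (wkb hp hπ hr1 ε (-δ) - wkb hp hπ hr1 ε δ) := by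
  have h0 : π ≠ 0 := norm_pos_iff.1 (norm_pi_pos hπ)
  have hδ : ((δ : ℤ) : ℂ_[p]) * ((δ : ℤ) : ℂ_[p]) = 1 := by
    rw [← Int.cast_mul, ← Units.val_mul, Int.units_mul_self]; simp
  have hε : ((ε : ℤ) : ℂ_[p]) * ((ε : ℤ) : ℂ_[p]) = 1 := by
    rw [← Int.cast_mul, ← Units.val_mul, Int.units_mul_self]; simp
  ext n
  rw [coeff_euler, coeff_add, coeff_mon_mul, coeff_mon_mul, coeff_sub, sub_zero]
  by_cases h : ∃ m : ℕ, n = -3 * m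
  · obtain ⟨m, rfl⟩ := h
    have e : -3 * (m : ℤ) - 3 = -3 * ((m + 1 : ℕ) : ℤ) := by push_cast; ring
    rw [e, coeff_wkb, coeff_wkb, coeff_wkb, pow_succ]
    have h1 := wkbB_eq h0 m
    have h2 : wkbA π m = 24 * π * wkbB π (m + 1) - 6 * m * wkbB π m := rfl
    push_cast [Units.val_neg]
    linear_combination (((ε : ℤ) : ℂ_[p]) ^ m / 2) * h1 -
      (((ε : ℤ) : ℂ_[p]) ^ m * ((δ : ℤ) : ℂ_[p]) / 2) * h2 -
      (12 * π * ((ε : ℤ) : ℂ_[p]) ^ m * ((δ : ℤ) : ℂ_[p]) * wkbB π (m + 1)) * hε * (-1) -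
      (((ε : ℤ) : ℂ_[p]) ^ m * wkbB π m / 2) * hδ
  · have h' : ∀ m : ℕ, n ≠ -3 * m := fun m hm => h ⟨m, hm⟩
    rw [coeff_wkb_eq_zero hp hπ hr1 ε δ n h']
    by_cases h3 : n = 3
    · rw [h3, sub_self, coeff_wkb_zero, coeff_wkb_zero]
      ring
    · have h'' : ∀ m : ℕ, n - 3 ≠ -3 * m := fun m hm => by
        cases m with
        | zero => exact h3 (by push_cast at hm; omega)
        | succ m => exact h ⟨m, by push_cast at hm; omega⟩
      rw [coeff_wkb_eq_zero hp hπ hr1 ε δ _ h'', coeff_wkb_eq_zero hp hπ hr1 ε (-δ) _ h'']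
      ring

namespace CircleSeries

theorem coeff_mul_of_pos {f g : CircleSeries ℂ_[p] r} (hf : ∀ n > 0, f.coeff n = 0)
    (hg : ∀ n > 0, g.coeff n = 0) (n : ℤ) (hn : 0 < n) : (f * g).coeff n = 0 := by
  rw [coeff_mul]
  refine (tsum_congr fun m => ?_).trans tsum_zero
  by_cases h : 0 < m
  · rw [hf m h, zero_mul]
  · rw [hg (n - m) (by omega), mul_zero]

theorem coeff_mul_zero {f g : CircleSeries ℂ_[p] r} (hf : ∀ n > 0, f.coeff n = 0)
    (hg : ∀ n > 0, g.coeff n = 0) : (f * g).coeff 0 = f.coeff 0 * g.coeff 0 := by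
  rw [coeff_mul, tsum_eq_single 0 fun m hm => ?_, sub_zero]
  by_cases h : 0 < m
  · rw [hf m h, zero_mul]
  · rw [hg (0 - m) (by omega), mul_zero]

theorem coeff_pow_of_pos {f : CircleSeries ℂ_[p] r} (hf : ∀ n > 0, f.coeff n = 0) (e : ℕ) :
    (∀ n > 0, (f ^ e).coeff n = 0) ∧ (f ^ e).coeff 0 = f.coeff 0 ^ e := by
  induction e with
  | zero =>
    simp only [pow_zero, one_def, coeff_mon]
    exact ⟨fun n hn => if_neg hn.ne', if_pos trivial⟩
  | succ e ih =>
    rw [pow_succ, pow_succ]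
    exact ⟨coeff_mul_of_pos ih.1 hf, by rw [coeff_mul_zero ih.1 hf, ih.2]⟩

end CircleSeries

/-- The factor `P_ε` of the solution `s^(-1/2) exp(2 ε π s³) P_ε`. -/
def wkbP (ε : ℤˣ) : CircleSeries ℂ_[p] r := wkb hp hπ hr1 ε 1

/-- The series `Q_ε = -ε s R_ε`, the factor of `π⁻¹` times the derivative in `a` of the solution. -/
def wkbQ (ε : ℤˣ) : CircleSeries ℂ_[p] r := mon r 1 (-((ε : ℤ) : ℂ_[p])) * wkb hp hπ hr1 ε (-1)

variable (π r) in
/-- The logarithmic derivative `6 ε π s³ - 1/2` of the factor `s^(-1/2) exp(2 ε π s³)` under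
`s d/ds`. -/
def wkbExponent (ε : ℤˣ) : CircleSeries ℂ_[p] r :=
  mon r 3 (6 * π * (ε : ℤ)) + mon r 0 (-(1 / 2))

theorem units_sq (ε : ℤˣ) : ((ε : ℤ) : ℂ_[p]) * ((ε : ℤ) : ℂ_[p]) = 1 := by
  rw [← Int.cast_mul, ← Units.val_mul, Int.units_mul_self]; simp

theorem euler_mon (j : ℤ) (c : ℂ_[p]) : euler (mon r j c) = mon r j (j * c) := by
  ext n
  rw [coeff_euler, coeff_mon, coeff_mon]
  split_ifs with h
  · rw [h]
  · rw [mul_zero]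

theorem mon_neg (j : ℤ) (c : ℂ_[p]) : mon r j (-c) = -mon r j c := by
  ext n
  rw [coeff_neg, coeff_mon, coeff_mon]
  split_ifs <;> simp

theorem euler_wkbP (ε : ℤˣ) : euler (wkbP hp hπ hr1 ε) + wkbExponent π r ε * wkbP hp hπ hr1 ε =
    mon r 2 (-6 * π) * wkbQ hp hπ hr1 ε := by
  rw [wkbP, wkbQ, wkbExponent, euler_wkb, ← mul_assoc, mon_mul_mon, mon_neg]
  have e : -6 * π * -((ε : ℤ) : ℂ_[p]) = 6 * π * (ε : ℤ) := by ring
  rw [e]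
  simp only [Units.val_one, Int.cast_one]
  norm_num
  ring

theorem euler_wkbQ (ε : ℤˣ) : euler (wkbQ hp hπ hr1 ε) + wkbExponent π r ε * wkbQ hp hπ hr1 ε =
    mon r 4 (-6 * π) * wkbP hp hπ hr1 ε := by
  rw [wkbP, wkbQ, wkbExponent, euler_mul, euler_wkb, euler_mon]
  have e1 : mon r 3 (6 * π * (ε : ℤ)) * mon r 1 (-((ε : ℤ) : ℂ_[p])) = mon r 4 (-6 * π) := by
    rw [mon_mul_mon]
    norm_num
    congr 1
    linear_combination (-6 * π) * units_sq (p := p) ε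
  have e2 : mon r 0 ((((-1 : ℤˣ) : ℤ) : ℂ_[p]) / 2) = mon r 0 (-(1 / 2) : ℂ_[p]) := by
    congr 1; push_cast [Units.val_neg]; norm_num
  have e3 : mon r 0 (-(1 / 2) : ℂ_[p]) + mon r 0 (-(1 / 2)) = -1 := by
    rw [← mon_add, one_def, ← mon_neg]; congr 1; norm_num
  rw [e2, neg_neg, Int.cast_one, one_mul]
  linear_combination (wkb hp hπ hr1 ε 1) * e1 +
    (mon r 1 (-((ε : ℤ) : ℂ_[p])) * wkb hp hπ hr1 ε (-1)) * e3

theorem wkbExponent_add : wkbExponent π r 1 + wkbExponent π r (-1) = -1 := by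
  have e3 : mon r 0 (-(1 / 2) : ℂ_[p]) + mon r 0 (-(1 / 2)) = -1 := by
    rw [← mon_add, one_def, ← mon_neg]; congr 1; norm_num
  have e4 : 6 * π * (((-1 : ℤˣ) : ℤ) : ℂ_[p]) = -(6 * π * (((1 : ℤˣ) : ℤ) : ℂ_[p])) := by
    push_cast [Units.val_neg]; ring
  rw [wkbExponent, wkbExponent, e4, mon_neg 3]
  linear_combination e3

/-- The Wronskian of the two formal solutions at infinity is a monomial. -/
theorem wronskian_wkb : wkbP hp hπ hr1 1 * wkbQ hp hπ hr1 (-1) -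
    wkbP hp hπ hr1 (-1) * wkbQ hp hπ hr1 1 = mon r 1 8 := by
  set W := wkbP hp hπ hr1 1 * wkbQ hp hπ hr1 (-1) -
    wkbP hp hπ hr1 (-1) * wkbQ hp hπ hr1 1 with hW
  have hθ : euler W = W := by
    rw [hW, map_sub, euler_mul, euler_mul]
    linear_combination wkbQ hp hπ hr1 (-1) * euler_wkbP hp hπ hr1 1 +
      wkbP hp hπ hr1 1 * euler_wkbQ hp hπ hr1 (-1) -
      wkbQ hp hπ hr1 1 * euler_wkbP hp hπ hr1 (-1) -
      wkbP hp hπ hr1 (-1) * euler_wkbQ hp hπ hr1 1 - W * wkbExponent_add (π := π) (r := r)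
  ext n
  rw [coeff_mon]
  split_ifs with h
  · have e1 : W = mon r 1 1 * (wkb hp hπ hr1 1 1 * wkb hp hπ hr1 (-1) (-1) +
        wkb hp hπ hr1 (-1) 1 * wkb hp hπ hr1 1 (-1)) := by
      rw [hW, wkbP, wkbP, wkbQ, wkbQ, Units.val_neg, Units.val_one, Int.cast_neg, Int.cast_one,
        neg_neg, mon_neg]
      ring
    rw [h, e1, coeff_mon_mul, sub_self, coeff_add,
      coeff_mul_zero (coeff_wkb_pos hp hπ hr1 _ _) (coeff_wkb_pos hp hπ hr1 _ _),
      coeff_mul_zero (coeff_wkb_pos hp hπ hr1 _ _) (coeff_wkb_pos hp hπ hr1 _ _)]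
    simp only [coeff_wkb_zero]
    norm_num
  · have h1 := congrArg (fun f => coeff f n) hθ
    simp only [coeff_euler] at h1
    have h2 : ((n : ℂ_[p]) - 1) * W.coeff n = 0 := by linear_combination h1
    rcases mul_eq_zero.1 h2 with h3 | h3
    · exact absurd (by exact_mod_cast sub_eq_zero.1 h3) h
    · exact h3

end

/-! ### Symmetric powers of a connection of rank two -/

section PolynomialConnection

open MvPolynomial

variable {R : Type*} [CommRing R] (θ : R →+ R) (μ : Fin 2 → R)

/-- The map on `R[X₀, X₁]` that acts as `θ` on the coefficients and sends `Xᵢ` to `μᵢ Xᵢ`, extended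
by the Leibniz rule. -/
def polyConnection (F : MvPolynomial (Fin 2) R) : MvPolynomial (Fin 2) R :=
  ∑ d ∈ F.support, monomial d (θ (coeff d F) + (d 0 * μ 0 + d 1 * μ 1) * coeff d F)

theorem coeff_polyConnection (F : MvPolynomial (Fin 2) R) (d : Fin 2 →₀ ℕ) :
    coeff d (polyConnection θ μ F) = θ (coeff d F) + (d 0 * μ 0 + d 1 * μ 1) * coeff d F := by
  classical
  simp only [polyConnection, coeff_sum, coeff_monomial]
  rw [Finset.sum_ite_eq' F.support d]
  split_ifs with h
  · rfl
  · rw [notMem_support_iff.1 h]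
    simp

theorem polyConnection_add (F G : MvPolynomial (Fin 2) R) :
    polyConnection θ μ (F + G) = polyConnection θ μ F + polyConnection θ μ G := by
  ext d
  simp only [coeff_polyConnection, coeff_add, map_add]
  ring

theorem polyConnection_mul (hθ : ∀ f g, θ (f * g) = θ f * g + f * θ g)
    (F G : MvPolynomial (Fin 2) R) :
    polyConnection θ μ (F * G) = polyConnection θ μ F * G + F * polyConnection θ μ G := by
  classical
  ext d
  rw [coeff_polyConnection, coeff_add, coeff_mul, coeff_mul, coeff_mul, map_sum, Finset.mul_sum,
    ← Finset.sum_add_distrib, ← Finset.sum_add_distrib]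
  refine Finset.sum_congr rfl fun x hx => ?_
  rw [coeff_polyConnection, coeff_polyConnection, hθ, ← Finset.HasAntidiagonal.mem_antidiagonal.1 hx]
  simp only [Finsupp.add_apply]
  push_cast
  ring

theorem polyConnection_C (f : R) : polyConnection θ μ (C f) = C (θ f) := by
  classical
  ext d
  rw [coeff_polyConnection, coeff_C, coeff_C]
  split_ifs with h
  · subst h; simp
  · simp

theorem polyConnection_X (hθ : ∀ f g, θ (f * g) = θ f * g + f * θ g) (i : Fin 2) : polyConnection θ μ (X i) = C (μ i) * X i := by
  classical
  have h1 : θ 1 = 0 := by simpa using hθ 1 1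
  ext d
  rw [coeff_polyConnection, coeff_C_mul, MvPolynomial.coeff_X]
  split_ifs with h
  · subst h
    fin_cases i <;> simp [h1]
  · simp

end PolynomialConnection

section SymmetricAlgebra

open MvPolynomial

variable {C₀ A R M : Type*} [CommRing C₀] [CommRing A] [CommRing R] [Algebra C₀ A] [Algebra A R]
  [AddCommGroup M] [Module A M] [Module C₀ M] [IsScalarTower C₀ A M]
  (e : Module.Basis (Fin 2) A M) (P Q : Fin 2 → R)

/-- The homomorphism `Sym_A M → R[X₀, X₁]` that sends the basis `e₀, e₁` of `M` to the linear forms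
`P₀ X₀ + P₁ X₁` and `Q₀ X₀ + Q₁ X₁`. -/
def symSubst : SymmetricAlgebra A M →ₐ[A] MvPolynomial (Fin 2) R :=
  SymmetricAlgebra.lift (e.constr A ![C (P 0) * X 0 + C (P 1) * X 1, C (Q 0) * X 0 + C (Q 1) * X 1])

theorem symSubst_zero : symSubst e P Q (SymmetricAlgebra.ι A M (e 0)) =
    C (P 0) * X 0 + C (P 1) * X 1 := by
  rw [symSubst, SymmetricAlgebra.lift_ι_apply, Module.Basis.constr_basis]
  rfl

theorem symSubst_one : symSubst e P Q (SymmetricAlgebra.ι A M (e 1)) =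
    C (Q 0) * X 0 + C (Q 1) * X 1 := by
  rw [symSubst, SymmetricAlgebra.lift_ι_apply, Module.Basis.constr_basis]
  rfl

theorem symSubst_ι_isHomogeneous (m : M) :
    (symSubst e P Q (SymmetricAlgebra.ι A M m)).IsHomogeneous 1 := by
  rw [← e.sum_repr m, Fin.sum_univ_two, map_add, map_add, map_smul, map_smul, map_smul, map_smul,
    symSubst_zero, symSubst_one, Algebra.smul_def, Algebra.smul_def, MvPolynomial.algebraMap_apply,
    MvPolynomial.algebraMap_apply]
  have h : ∀ (f : R) (i : Fin 2), (C f * X i : MvPolynomial (Fin 2) R).IsHomogeneous 1 :=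
    fun f i => by simpa using (isHomogeneous_C (Fin 2) f).mul (isHomogeneous_X R i)
  have h' : ∀ (f : R) {G : MvPolynomial (Fin 2) R}, G.IsHomogeneous 1 →
      (C f * G).IsHomogeneous 1 :=
    fun f G hG => by simpa using (isHomogeneous_C (Fin 2) f).mul hG
  exact (h' _ ((h _ _).add (h _ _))).add (h' _ ((h _ _).add (h _ _)))

theorem symSubst_isHomogeneous (k : ℕ) (u : SymmetricAlgebra A M) (hu : u ∈ symPow A M k) :
    (symSubst e P Q u).IsHomogeneous k := by
  unfold symPow at hu
  induction k generalizing u with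
  | zero =>
    rw [pow_zero, Submodule.mem_one] at hu
    obtain ⟨r, rfl⟩ := hu
    rw [AlgHom.commutes, MvPolynomial.algebraMap_apply]
    exact isHomogeneous_C _ _
  | succ k ih =>
    rw [pow_succ] at hu
    induction hu using Submodule.mul_induction_on' with
    | mem_mul_mem a ha c hc =>
      obtain ⟨m, rfl⟩ := hc
      rw [map_mul]
      exact (ih a ha).mul (symSubst_ι_isHomogeneous e P Q m)
    | add a _ c _ ha hc => rw [map_add]; exact ha.add hc

theorem symSubst_injective (hA : Function.Injective (algebraMap A R)) (W : R)
    (hW : W * (P 0 * Q 1 - P 1 * Q 0) = 1) : Function.Injective (symSubst e P Q) := by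
  let Θ : MvPolynomial (Fin 2) R →ₐ[R] MvPolynomial (Fin 2) R :=
    aeval ![C W * (C (Q 1) * X 0 - C (P 1) * X 1), C W * (C (P 0) * X 1 - C (Q 0) * X 0)]
  have hΘ : (Θ.restrictScalars A).comp (symSubst e P Q) =
      (mapAlgHom (Algebra.ofId A R)).comp
        (SymmetricAlgebra.equivMvPolynomial e : SymmetricAlgebra A M →ₐ[A] _) := by
    apply SymmetricAlgebra.algHom_ext
    refine e.ext fun i => ?_
    have hW' : C W * (C (P 0) * C (Q 1) - C (P 1) * C (Q 0)) =
        (1 : MvPolynomial (Fin 2) R) := by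
      rw [← map_mul, ← map_mul, ← map_sub, ← map_mul, hW, map_one]
    have hC : ∀ f : R, Θ (C f) = C f := fun f => Θ.commutes f
    have h0 : Θ (X 0) = C W * (C (Q 1) * X 0 - C (P 1) * X 1) := aeval_X _ _
    have h1 : Θ (X 1) = C W * (C (P 0) * X 1 - C (Q 0) * X 0) := aeval_X _ _
    have hR : ∀ i, mapAlgHom (Algebra.ofId A R) (SymmetricAlgebra.equivMvPolynomial e
        (SymmetricAlgebra.ι A M (e i))) = X i := fun i => by
      rw [SymmetricAlgebra.equivMvPolynomial_ι_apply]
      exact map_X (algebraMap A R) i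
    fin_cases i
    · refine Eq.trans ?_ (hR 0).symm
      change Θ (symSubst e P Q (SymmetricAlgebra.ι A M (e 0))) = _
      rw [symSubst_zero, map_add, map_mul, map_mul, hC, hC, h0, h1]
      linear_combination (X 0) * hW'
    · refine Eq.trans ?_ (hR 1).symm
      change Θ (symSubst e P Q (SymmetricAlgebra.ι A M (e 1))) = _
      rw [symSubst_one, map_add, map_mul, map_mul, hC, hC, h0, h1]
      linear_combination (X 1) * hW'
  have hinj : Function.Injective ((Θ.restrictScalars A).comp (symSubst e P Q)) := by
    rw [hΘ]
    exact (map_injective (algebraMap A R) hA).comp (SymmetricAlgebra.equivMvPolynomial e).injective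
  exact Function.Injective.of_comp (f := Θ) hinj

theorem eval_symSubst_mem (W : R) (hW : W * (P 0 * Q 1 - P 1 * Q 0) = 1)
    (u : SymmetricAlgebra A M) :
    ∃ c : A, aeval ![-(W * P 1), W * P 0] (symSubst e P Q u) = algebraMap A R c := by
  let Θ : MvPolynomial (Fin 2) R →ₐ[R] R := aeval ![-(W * P 1), W * P 0]
  have hΘ : (Θ.restrictScalars A).comp (symSubst e P Q) =
      (Algebra.ofId A R).comp (SymmetricAlgebra.lift (e.coord 1)) := by
    apply SymmetricAlgebra.algHom_ext
    refine e.ext fun i => ?_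
    have hC : ∀ f : R, Θ (C f) = f := fun f => Θ.commutes f
    have h0 : Θ (X 0) = -(W * P 1) := aeval_X _ _
    have h1 : Θ (X 1) = W * P 0 := aeval_X _ _
    have hR : ∀ i, (Algebra.ofId A R) (SymmetricAlgebra.lift (e.coord 1)
        (SymmetricAlgebra.ι A M (e i))) = if i = 1 then 1 else 0 := fun i => by
      rw [SymmetricAlgebra.lift_ι_apply, Module.Basis.coord_apply, Module.Basis.repr_self,
        Finsupp.single_apply]
      split_ifs <;> simp
    fin_cases i
    · refine Eq.trans ?_ (hR 0).symm
      change Θ (symSubst e P Q (SymmetricAlgebra.ι A M (e 0))) = _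
      rw [symSubst_zero, map_add, map_mul, map_mul, hC, hC, h0, h1, if_neg (by decide)]
      ring
    · refine Eq.trans ?_ (hR 1).symm
      change Θ (symSubst e P Q (SymmetricAlgebra.ι A M (e 1))) = _
      rw [symSubst_one, map_add, map_mul, map_mul, hC, hC, h0, h1, if_pos rfl]
      linear_combination hW
  exact ⟨_, congrArg (fun F : SymmetricAlgebra A M →ₐ[A] R => F u) hΘ⟩

variable {e P Q}

/-- If the rows `P` and `Q` solve the differential system of the connection, up to the exponents `μ`,
then `symSubst` is compatible with the connections. The factor `2` comes from `a = c s²`, for which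
`s d/ds = 2 a d/da`. -/
theorem polyConnection_symSubst (δ : Derivation C₀ A A) (D : M →ₗ[C₀] M)
    (hD : ∀ (r : A) (m : M), D (r • m) = δ r • m + r • D m)
    (θ : R →+ R) (hθ : ∀ f g, θ (f * g) = θ f * g + f * θ g) (μ : Fin 2 → R)
    (hδ : ∀ f, θ (algebraMap A R f) = 2 * algebraMap A R (δ f)) (f₀ f₁ : A)
    (h0 : D (e 0) = f₀ • e 1) (h1 : D (e 1) = f₁ • e 0)
    (hP : ∀ i, θ (P i) + μ i * P i = 2 * algebraMap A R f₀ * Q i)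
    (hQ : ∀ i, θ (Q i) + μ i * Q i = 2 * algebraMap A R f₁ * P i) (u : SymmetricAlgebra A M) :
    polyConnection θ μ (symSubst e P Q u) = 2 * symSubst e P Q (symDerivation δ D hD u) := by
  have hm : ∀ f g, polyConnection θ μ (C f * X 0 + C g * X 1) =
      C (θ f + μ 0 * f) * X 0 + C (θ g + μ 1 * g) * X 1 := fun f g => by
    rw [polyConnection_add, polyConnection_mul θ μ hθ, polyConnection_mul θ μ hθ,
      polyConnection_C, polyConnection_C, polyConnection_X θ μ hθ, polyConnection_X θ μ hθ,
      map_add, map_add, map_mul, map_mul]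
    ring
  have h2 : (C 2 : MvPolynomial (Fin 2) R) = 2 := map_ofNat C 2
  have hs : ∀ r : A, polyConnection θ μ (C (algebraMap A R r)) =
      2 * C (algebraMap A R (δ r)) := fun r => by
    rw [polyConnection_C, hδ, map_mul, h2]
  induction u using SymmetricAlgebra.induction with
  | algebraMap r =>
    rw [symDerivation_algebraMap, AlgHom.commutes, AlgHom.commutes, MvPolynomial.algebraMap_apply,
      MvPolynomial.algebraMap_apply, hs]
  | ι m =>
    rw [symDerivation_ι]
    have key : ∀ (r : A) (i : Fin 2), polyConnection θ μ (symSubst e P Q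
        (SymmetricAlgebra.ι A M (e i))) = 2 * symSubst e P Q (SymmetricAlgebra.ι A M (D (e i))) →
        polyConnection θ μ (symSubst e P Q (SymmetricAlgebra.ι A M (r • e i))) =
        2 * symSubst e P Q (SymmetricAlgebra.ι A M (D (r • e i))) := fun r i hi => by
      rw [hD, map_add, map_add, map_smul, map_smul, map_smul, map_smul, map_smul, map_smul,
        Algebra.smul_def, Algebra.smul_def, Algebra.smul_def, MvPolynomial.algebraMap_apply, MvPolynomial.algebraMap_apply,
        polyConnection_mul θ μ hθ, hs, hi]
      ring
    have k0 : polyConnection θ μ (symSubst e P Q (SymmetricAlgebra.ι A M (e 0))) =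
        2 * symSubst e P Q (SymmetricAlgebra.ι A M (D (e 0))) := by
      rw [h0, map_smul, map_smul, symSubst_zero, symSubst_one, hm, hP, hP, Algebra.smul_def,
        MvPolynomial.algebraMap_apply]
      simp only [map_mul, h2]
      ring
    have k1 : polyConnection θ μ (symSubst e P Q (SymmetricAlgebra.ι A M (e 1))) =
        2 * symSubst e P Q (SymmetricAlgebra.ι A M (D (e 1))) := by
      rw [h1, map_smul, map_smul, symSubst_zero, symSubst_one, hm, hQ, hQ, Algebra.smul_def,
        MvPolynomial.algebraMap_apply]
      simp only [map_mul, h2]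
      ring
    rw [← e.sum_repr m, Fin.sum_univ_two, map_add, map_add, polyConnection_add, key _ 0 k0,
      key _ 1 k1, map_add, map_add, map_add]
    ring
  | mul a b ha hb =>
    rw [map_mul, polyConnection_mul θ μ hθ, ha, hb, Derivation.leibniz, map_add, smul_eq_mul,
      smul_eq_mul, map_mul, map_mul]
    ring
  | add a b ha hb => rw [map_add, polyConnection_add, ha, hb, map_add, map_add]; ring

end SymmetricAlgebra

/-! ### Horizontal elements of the symmetric powers -/

section

variable {p : ℕ} [Fact p.Prime] {π : ℂ_[p]}

theorem ordGE_inv_pi_mul_three (hp : 5 ≤ p) (hπ : π ^ (p - 1) = -(p : ℂ_[p])) :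
    OrdGE p (π * 3)⁻¹ (-(1 / ((p : ℝ) - 1))) ∧ OrdGE p (3 : ℂ_[p])⁻¹ 0 := by
  have hpr := (Fact.out : p.Prime)
  have hp0 : (0 : ℝ) < p := by exact_mod_cast hpr.pos
  have hp1 : (0 : ℝ) < (p : ℝ) - 1 := by
    have : (1 : ℝ) < p := by exact_mod_cast hpr.one_lt
    linarith
  have h3 : ‖(3 : ℂ_[p])‖ = 1 := by
    have : ¬ (p : ℤ) ∣ 3 := fun h => by
      have := Int.le_of_dvd (by norm_num) h
      omega
    simpa using norm_intCast_eq_one (p := p) this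
  have hpos := norm_pi_pos hπ
  have h1 : ‖π‖ = (p : ℝ) ^ (-(1 / ((p : ℝ) - 1))) := by
    have h2 := norm_pi_pow hπ
    have h4 : ‖π‖ = (‖π‖ ^ (p - 1)) ^ (1 / ((p : ℝ) - 1)) := by
      rw [← Real.rpow_natCast, ← Real.rpow_mul hpos.le, Nat.cast_sub hpr.one_lt.le, Nat.cast_one,
        mul_one_div_cancel hp1.ne', Real.rpow_one]
    rw [h4, h2, Real.inv_rpow hp0.le, Real.rpow_neg hp0.le]
  constructor
  · unfold OrdGE
    rw [norm_inv, norm_mul, h3, mul_one, h1, ← Real.rpow_neg hp0.le]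
  · unfold OrdGE
    rw [norm_inv, h3]
    simp

/-- There is a circle slightly larger than the unit circle on which the substitution `a = -3 s²` of
elements of `L(b')` converges. -/
theorem exists_radius (b' : ℝ) (hb' : 0 < b') :
    ∃ r : ℝ, 0 < r ∧ 1 < r ∧ r ^ 3 < p ∧ r ^ 2 < (p : ℝ) ^ (b' * (1 - 1 / 3)) := by
  have hp1 : (1 : ℝ) < p := by exact_mod_cast (Fact.out : p.Prime).one_lt
  have hp0 : (0 : ℝ) < p := by linarith
  set t := min b' 1 / 4 with ht
  have h1 : min b' 1 ≤ b' := min_le_left _ _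
  have h2 : min b' 1 ≤ 1 := min_le_right _ _
  have h3 : 0 < min b' 1 := lt_min hb' one_pos
  refine ⟨(p : ℝ) ^ t, by positivity, Real.one_lt_rpow hp1 (by positivity), ?_, ?_⟩
  · rw [← Real.rpow_natCast, ← Real.rpow_mul hp0.le]
    nth_rewrite 2 [← Real.rpow_one (p : ℝ)]
    refine Real.rpow_lt_rpow_of_exponent_lt hp1 ?_
    push_cast
    linarith
  · rw [← Real.rpow_natCast, ← Real.rpow_mul hp0.le]
    refine Real.rpow_lt_rpow_of_exponent_lt hp1 ?_
    push_cast
    linarith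

variable {r : ℝ} [hr : Fact (0 < r)]

open CircleSeries

theorem mon_pow (j : ℤ) (c : ℂ_[p]) (e : ℕ) : mon r j c ^ e = mon r (e * j) (c ^ e) := by
  induction e with
  | zero => simp [one_def]
  | succ e ih => rw [pow_succ, ih, mon_mul_mon, pow_succ]; congr 1; push_cast; ring

/-- The coefficient equations of `(s d/ds + i μ₊ + j μ₋) f = 0`. -/
theorem recurrence_of_euler_eq (i j k : ℕ) (hk : i + j = k) (f : CircleSeries ℂ_[p] r)
    (h : euler f + (i * wkbExponent π r 1 + j * wkbExponent π r (-1)) * f = 0) (n : ℤ) :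
    ((2 * n - k : ℤ) : ℂ_[p]) * f.coeff n = -12 * π * ((i - j : ℤ) : ℂ_[p]) * f.coeff (n - 3) := by
  have e1 : ∀ m : ℕ, (m : CircleSeries ℂ_[p] r) = mon r 0 (m : ℂ_[p]) := fun m => by
    induction m with
    | zero => ext n; rw [coeff_mon]; simp
    | succ m ih => rw [Nat.cast_succ, ih, one_def, ← mon_add]; push_cast; rfl
  have e2 := congrArg (fun g => CircleSeries.coeff g n) h
  simp only [wkbExponent, e1, mul_add, mon_mul_mon, add_mul, coeff_add, coeff_mon_mul, coeff_euler,
    CircleSeries.coeff_zero] at e2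
  norm_num at e2
  rw [← hk]
  push_cast
  linear_combination 2 * e2

theorem eq_zero_or_balanced (hp : 5 ≤ p) (hπ : π ^ (p - 1) = -(p : ℂ_[p])) (hr1 : 1 < r)
    (hrp : r ^ 3 < p) {i j k : ℕ} (hk' : Odd k ∨ (Even k ∧ k < 2 * p)) (hk : i + j = k)
    (f : CircleSeries ℂ_[p] r)
    (h : euler f + (i * wkbExponent π r 1 + j * wkbExponent π r (-1)) * f = 0) :
    f = 0 ∨ i = j := by
  have hpr := (Fact.out : p.Prime)
  have hrec := recurrence_of_euler_eq i j k hk f h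
  have hcop : ∀ a : ℤ, ¬ (p : ℤ) ∣ a → ¬ (p : ℤ) ∣ 12 * a := fun a ha hd => by
    have hpi := Nat.prime_iff_prime_int.1 hpr
    rcases hpi.dvd_mul.1 hd with h1 | h1
    · rw [show (12 : ℤ) = 2 ^ 2 * 3 by norm_num] at h1
      rcases hpi.dvd_mul.1 h1 with h2 | h2
      · have := Int.le_of_dvd (by norm_num) (hpi.dvd_of_dvd_pow h2)
        omega
      · have := Int.le_of_dvd (by norm_num) h2
        omega
    · exact ha h1
  have h6 : ¬ (p : ℤ) ∣ 6 := fun hd => hcop 1 (fun h1 => by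
    have := Int.le_of_dvd (by norm_num) h1
    omega) (by simpa using hd.mul_left 2)
  by_cases hd : (p : ℤ) ∣ ((i : ℤ) - j)
  · rcases hk' with ho | ⟨he, hlt⟩
    · left
      exact eq_zero_of_dvd (k := k) hπ hrp hrec hd (by exact_mod_cast ho) h6
    · -- `i - j` is even, divisible by `p`, and smaller than `2 p` in absolute value
      right
      have h2 : (2 : ℤ) ∣ ((i : ℤ) - j) := by
        obtain ⟨l, hl⟩ := he
        exact ⟨l - j, by omega⟩
      have hc2 : IsCoprime (p : ℤ) 2 := by
        refine (Nat.prime_iff_prime_int.1 hpr).coprime_iff_not_dvd.2 fun h1 => ?_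
        have := Int.le_of_dvd (by norm_num) h1
        omega
      have h2p := hc2.mul_dvd hd h2
      have := Int.eq_zero_of_abs_lt_dvd h2p (by rw [abs_lt]; constructor <;> omega)
      omega
  · left
    exact eq_zero_of_not_dvd (k := k) hπ hr1 hrec (hcop _ hd) h6

end

section

open CircleSeries MvPolynomial

variable {p : ℕ} [Fact p.Prime] {π : ℂ_[p]} {r : ℝ} [hr : Fact (0 < r)]

/-- A multiple `f (X₀ X₁)ʰ` of the balanced monomial, horizontal for the connection, comes from
`Sym M` over `L(b')` only when `f = 0`: such an `f` is `c sʰ`, and the substitution that recovers the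
coefficient of `e₁²ʰ` gives a series in `s` of leading term `± (c / 16ʰ) s⁻ʰ`. -/
theorem eq_zero_of_balanced (hp : 5 ≤ p) (hπ : π ^ (p - 1) = -(p : ℂ_[p])) (hr1 : 1 < r)
    (h : ℕ) (hh : 0 < h) (f : CircleSeries ℂ_[p] r)
    (hf : euler f + (h * wkbExponent π r 1 + h * wkbExponent π r (-1)) * f = 0)
    (hneg : ∀ n < 0, (f * (-(mon r (-1) (1 / 8) * wkbP hp hπ hr1 (-1))) ^ h *
      (mon r (-1) (1 / 8) * wkbP hp hπ hr1 1) ^ h).coeff n = 0) : f = 0 := by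
  have hrec := recurrence_of_euler_eq h h (2 * h) (two_mul h).symm f hf
  have hmon : f = mon r h (f.coeff h) := by
    ext n
    rw [coeff_mon]
    split_ifs with hn
    · rw [hn]
    · have h1 := hrec n
      simp only [sub_self, Int.cast_zero, mul_zero, zero_mul] at h1
      rcases mul_eq_zero.1 h1 with h2 | h2
      · have h3 : (2 * n - (2 * h : ℕ) : ℤ) = 0 := by exact_mod_cast h2
        exact absurd (by push_cast at h3; omega) hn
      · exact h2
  set c := f.coeff h with hc
  set PP := wkbP hp hπ hr1 (-1) * wkbP hp hπ hr1 1 with hPP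
  have hpos : ∀ ε, ∀ n > 0, (wkbP hp hπ hr1 ε).coeff n = 0 := fun ε n hn =>
    coeff_wkb_pos hp hπ hr1 ε 1 n hn
  have hz : ∀ ε, (wkbP hp hπ hr1 ε).coeff 0 = 2 := fun ε => coeff_wkb_zero hp hπ hr1 ε 1
  have hPP0 : PP.coeff 0 = 4 := by
    rw [hPP, coeff_mul_zero (hpos _) (hpos _), hz, hz]; norm_num
  have hpow := coeff_pow_of_pos (coeff_mul_of_pos (hpos (-1)) (hpos 1)) h
  rw [← hPP, hPP0] at hpow
  have e1 : f * (-(mon r (-1) (1 / 8) * wkbP hp hπ hr1 (-1))) ^ h *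
      (mon r (-1) (1 / 8) * wkbP hp hπ hr1 1) ^ h =
      mon r (-h) (c * ((-1) ^ h * (1 / 8) ^ h * (1 / 8) ^ h)) * PP ^ h := by
    have e2 : -(mon r (-1) (1 / 8) * wkbP hp hπ hr1 (-1)) =
        mon r (-1) (-(1 / 8) : ℂ_[p]) * wkbP hp hπ hr1 (-1) := by rw [mon_neg]; ring
    have e3 : mon r h c * (mon r (h * -1) ((-(1 / 8) : ℂ_[p]) ^ h) * mon r (h * -1) ((1 / 8) ^ h)) =
        mon r (-h) (c * ((-1) ^ h * (1 / 8) ^ h * (1 / 8) ^ h)) := by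
      rw [mon_mul_mon, mon_mul_mon]
      congr 1
      · ring
      · rw [neg_pow]
    rw [hmon, e2, mul_pow, mul_pow, mon_pow, mon_pow, ← e3, hPP, mul_pow]
    ring
  have h1 := hneg (-h) (by omega)
  rw [e1, coeff_mon_mul, sub_self, hpow.2] at h1
  have hc0 : c = 0 := by
    rcases mul_eq_zero.1 h1 with h2 | h2
    · rcases mul_eq_zero.1 h2 with h3 | h3
      · exact h3
      · exact absurd h3 (mul_ne_zero (mul_ne_zero (pow_ne_zero _ (by norm_num))
          (pow_ne_zero _ (by norm_num))) (pow_ne_zero _ (by norm_num)))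
    · exact absurd h2 (pow_ne_zero _ (by norm_num))
  rw [hmon, hc0]
  ext n
  rw [coeff_mon]
  split_ifs <;> rfl

/-- The image of a horizontal element under `symSubst` has only balanced monomials `(X₀ X₁)ʰ`, by
`eq_zero_or_balanced`, and these are excluded by `eq_zero_of_balanced`. -/
theorem symDerivation_eq_zero_imp (hp : 5 ≤ p) (hπ : π ^ (p - 1) = -(p : ℂ_[p]))
    {b' b : ℝ} (hb' : 0 < b') (hb'b : b' ≤ b) (hb : 1 / ((p : ℝ) - 1) < b)
    {k : ℕ} (hk : 0 < k) (hk' : Odd k ∨ (Even k ∧ k < 2 * p))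
    (u : SymmetricAlgebra (L ℂ_[p] p b') (Ma ℂ_[p] p π b' b))
    (hu : u ∈ symPow (L ℂ_[p] p b') (Ma ℂ_[p] p π b' b) k)
    (hker : symDerivation (eulerL ℂ_[p] p b') (partialMa ℂ_[p] p π b' b)
      (partialMa_smul ℂ_[p] p π b' b) u = 0) : u = 0 := by
  obtain ⟨h1, h3⟩ := ordGE_inv_pi_mul_three hp hπ
  obtain ⟨r, hr0, hr1, hrp, hrL⟩ := exists_radius (p := p) b' hb'
  have : Fact (0 < r) := ⟨hr0⟩
  have h0 : π ≠ 0 := norm_pos_iff.1 (norm_pi_pos hπ)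
  have h30 : (3 : ℂ_[p]) ≠ 0 := by norm_num
  let e : Module.Basis (Fin 2) (L ℂ_[p] p b') (Ma ℂ_[p] p π b' b) :=
    Module.Basis.mk (linearIndependent_powerClass π h0 h30 h1 h3 hb'b hb)
      (span_powerClass π h0 h30 h1 h3 hb'b hb)
  have he : ∀ i, e i = powerClass p π b' b i := fun i => Module.Basis.mk_apply _ _ i
  have hc : ‖(-3 : ℂ_[p])‖ ≤ 1 := by
    simpa using IsUltrametricDist.norm_intCast_le_one ℂ_[p] (-3)
  let _ : Algebra (L ℂ_[p] p b') (CircleSeries ℂ_[p] r) :=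
    (circleOfL (-3 : ℂ_[p]) hc hrL).toAlgebra
  have halg : ∀ f, algebraMap (L ℂ_[p] p b') (CircleSeries ℂ_[p] r) f =
    circleOfL (-3 : ℂ_[p]) hc hrL f := fun f => rfl
  let sgn : Fin 2 → ℤˣ := ![1, -1]
  let P : Fin 2 → CircleSeries ℂ_[p] r := fun i => wkbP hp hπ hr1 (sgn i)
  let Q : Fin 2 → CircleSeries ℂ_[p] r := fun i => wkbQ hp hπ hr1 (sgn i)
  let μ : Fin 2 → CircleSeries ℂ_[p] r := fun i => wkbExponent π r (sgn i)
  have two_mon : ∀ j (c : ℂ_[p]), 2 * mon r j c = mon r j (2 * c) := fun j c => by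
    rw [two_mul, two_mul, mon_add]
  have hW : mon r (-1) (1 / 8) * (P 0 * Q 1 - P 1 * Q 0) = 1 := by
    change mon r (-1) (1 / 8) * (wkbP hp hπ hr1 1 * wkbQ hp hπ hr1 (-1) -
      wkbP hp hπ hr1 (-1) * wkbQ hp hπ hr1 1) = 1
    rw [wronskian_wkb, mon_mul_mon, CircleSeries.one_def]
    norm_num
  have hcomm := polyConnection_symSubst (e := e) (P := P) (Q := Q) (eulerL ℂ_[p] p b')
    (partialMa ℂ_[p] p π b' b) (partialMa_smul ℂ_[p] p π b' b) (euler (C := ℂ_[p]) (r := r))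
    euler_mul μ (fun f => euler_circleOfL _ hc hrL f) _ _
    (by rw [he, he, partialMa_powerClass_zero]) (by rw [he, he, partialMa_powerClass_one _ _ _ h30])
    (fun i => by
      rw [halg, map_mul, circleOfL_const, circleOfL_a, mon_mul_mon, two_mon]
      refine (euler_wkbP hp hπ hr1 (sgn i)).trans ?_
      congr 2
      ring)
    (fun i => by
      rw [halg, map_mul, map_pow, circleOfL_const, circleOfL_a, mon_pow, mon_mul_mon, two_mon]
      refine (euler_wkbQ hp hπ hr1 (sgn i)).trans ?_
      congr 2
      ring) u
  rw [hker, map_zero, mul_zero] at hcomm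
  set F := symSubst e P Q u with hF
  have hhom : F.IsHomogeneous k := symSubst_isHomogeneous e P Q k u hu
  refine symSubst_injective e P Q (circleOfL_injective (-3) hc hrL (by norm_num)) _ hW ?_
  rw [map_zero, ← hF]
  have hode : ∀ d : Fin 2 →₀ ℕ, euler (MvPolynomial.coeff d F) +
      (d 0 * wkbExponent π r 1 + d 1 * wkbExponent π r (-1)) * MvPolynomial.coeff d F = 0 :=
    fun d => by
      have := congrArg (MvPolynomial.coeff d) hcomm
      rwa [coeff_polyConnection, MvPolynomial.coeff_zero] at this
  have hdeg : ∀ d : Fin 2 →₀ ℕ, MvPolynomial.coeff d F ≠ 0 → d 0 + d 1 = k ∧ d 0 = d 1 :=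
    fun d hd => by
      have hk2 : d 0 + d 1 = k := by
        rw [← hhom hd, Finsupp.weight_apply, Finsupp.sum_fintype _ _ (by simp), Fin.sum_univ_two]
        simp
      exact ⟨hk2, (eq_zero_or_balanced hp hπ hr1 hrp hk' hk2 _ (hode d)).resolve_left hd⟩
  ext1 d
  rw [MvPolynomial.coeff_zero]
  by_contra hd
  obtain ⟨hd1, hd2⟩ := hdeg d hd
  -- the balanced monomial is the only one in `F`
  have hFd : F = monomial d (MvPolynomial.coeff d F) := by
    ext1 d'
    rw [MvPolynomial.coeff_monomial]
    split_ifs with hdd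
    · rw [hdd]
    · by_contra hne
      obtain ⟨hd1', hd2'⟩ := hdeg d' hne
      refine hdd (Finsupp.ext fun i => ?_)
      fin_cases i
      · change d 0 = d' 0; omega
      · change d 1 = d' 1; omega
  obtain ⟨c, hc'⟩ := eval_symSubst_mem e P Q _ hW u
  refine hd (eq_zero_of_balanced hp hπ hr1 (d 0) (by omega) _ ?_ fun n hn => ?_)
  · have := hode d
    rwa [← hd2] at this
  · rw [← hF, hFd, MvPolynomial.aeval_monomial, Finsupp.prod_fintype _ _ (by simp),
      Fin.prod_univ_two, ← hd2, ← mul_assoc] at hc'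
    have h2 := congrArg (fun f => CircleSeries.coeff f n) hc'
    refine Eq.trans h2 ?_
    rw [halg]
    exact coeff_circleOfL_eq_zero _ hc hrL c n fun m hm => by omega

end

end AiryCohomology

end

theorem theoremT (p : ℕ) [Fact p.Prime] (hp : 5 ≤ p) (π : ℂ_[p]) (hπ : π ^ (p - 1) = -(p : ℂ_[p]))
    (b' b : ℝ) (hb' : 0 < b') (hb'b : b' ≤ b) (hb : 1 / ((p : ℝ) - 1) < b)
    (k : ℕ) (hk : 0 < k) (hk' : Odd k ∨ (Even k ∧ k < 2 * p)) :
    AiryCohomology.H0 ℂ_[p] p π b' b k = ⊥ := by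
  rw [eq_bot_iff]
  intro u hu
  rw [Submodule.mem_bot]
  refine Subtype.ext (AiryCohomology.symDerivation_eq_zero_imp hp hπ hb' hb'b hb hk hk' u.1 u.2 ?_)
  exact congrArg Subtype.val (LinearMap.mem_ker.1 hu)
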